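/- Let $n\in\mathbb N$ and let $q_0,\dots,q_n$ be positive integers with $q_0=\gcd(q_1,\dots,q_n)=1$ (so $n\ge 1$), and put $m=\operatorname{lcm}(q_1,\dots,q_n)$. Let $P=\mathbb P^n(q_0,\dots,q_n)=\operatorname{Proj}\mathbb C[z_0,\dots,z_n]$, $\deg z_j=q_j$, be the (well-formed) weighted projective space over $\mathbb C$, let $D_j=\{z_j=0\}\subset P$ be the prime divisor defined by $z_j$, and for $a_0,\dots,a_n\in\mathbb Z$ let $\deg\bigl(\sum_j a_jD_j\bigr)=\sum_j q_ja_j$. A Weil divisor is called Cartier if it is locally principal, and ample if some positive integer multiple of it is an ample Cartier divisor (a Cartier divisor $E$ on $P$ is ample if every point of $P$ lies in an affine nonvanishing locus of some global section of $\mathcal O_P(kE)$ for some $k\ge 1$). Then for every Weil divisor $D=\sum_{j=0}^n a_jD_j$, with $d=\deg(D)$: (1) $D$ is Cartier if and only if $m\mid d$; (2) $D$ is ample if and only if $d>0$. Moreover $mD_0$ is an ample Cartier divisor, and $P$ is projective, i.e. it admits a closed immersion over $\mathbb C$ into some ordinary projective space $\mathbb P^N_{\mathbb C}$. -/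

import Mathlib

noncomputable section

open AlgebraicGeometry CategoryTheory

/-! ### Weil divisors on integral schemes, given by their local multiplicities -/

namespace WeilDivisor

variable {X : Scheme.{0}} [IsIntegral X] [IsLocallyNoetherian X]

/-- A Weil divisor `D` (a locally finite integral combination of codimension one points) is
Cartier if it is locally principal: each point has an open neighbourhood `U` on which
`D = div f` for a nonzero rational function `f`. -/
def IsCartier (D : AlgebraicCycle X ℤ) : Prop :=
  ∀ x : X, ∃ U : X.Opens, x ∈ U ∧ ∃ f : X.functionField, f ≠ 0 ∧
    ∀ y ∈ U, D y = Scheme.ord f y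

/-- The nonzero rational function `s` is a global section of `𝒪_X(D)`, that is,
`div s + D` is effective. (On a normal scheme this is the usual sheaf `𝒪_X(D)`.) -/
def IsNonzeroSection (D : AlgebraicCycle X ℤ) (s : X.functionField) : Prop :=
  s ≠ 0 ∧ ∀ y : X, 0 ≤ Scheme.ord s y + D y

/-- The nonvanishing locus `X_s` of a nonzero section `s` of `𝒪_X(D)`: the complement of
the union of the prime divisors (closures of points `y`) that occur in the divisor of zeros
`div s + D` of the section. -/
def nonvanishingLocus (D : AlgebraicCycle X ℤ) (s : X.functionField) : Set X :=
  {x | ∀ y : X, Scheme.ord s y + D y ≠ 0 → x ∉ closure {y}}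

/-- `D` is an ample Cartier divisor: `X` is quasi-compact, `D` is Cartier and every point of
`X` lies in an affine nonvanishing locus `X_s` of some section `s` of `𝒪_X(m D)`, `m ≥ 1`. -/
def IsAmpleCartier (D : AlgebraicCycle X ℤ) : Prop :=
  CompactSpace X ∧ IsCartier D ∧
    ∀ x : X, ∃ m : ℕ, 1 ≤ m ∧ ∃ s : X.functionField, IsNonzeroSection (m • D) s ∧
      ∃ U : X.Opens, (U : Set X) = nonvanishingLocus (m • D) s ∧ IsAffineOpen U ∧ x ∈ U

/-- A Weil divisor is ample if some positive multiple of it is an ample Cartier divisor. -/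
def IsAmple (D : AlgebraicCycle X ℤ) : Prop :=
  ∃ k : ℕ, 1 ≤ k ∧ IsAmpleCartier (k • D)

end WeilDivisor

/-! ### Weighted projective space -/

namespace WeightedProj

open MvPolynomial

variable {n : ℕ} (q : Fin (n + 1) → ℕ+)

/-- The grading of `ℂ[z₀, …, zₙ]` with `deg z_j = q_j`. -/
abbrev grading : ℕ → Submodule ℂ (MvPolynomial (Fin (n + 1)) ℂ) :=
  weightedHomogeneousSubmodule ℂ (fun j => (q j : ℕ))

instance instGradedAlgebra : GradedAlgebra (grading q) :=
  weightedGradedAlgebra ℂ (fun j => (q j : ℕ))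

/-- The weighted projective space `ℙⁿ(q₀, …, qₙ) = Proj ℂ[z₀, …, zₙ]`, `deg z_j = q_j`. -/
abbrev space : Scheme.{0} := Proj (grading q)

/-- The structure morphism `ℙⁿ(q₀, …, qₙ) ⟶ Spec ℂ`. -/
def structureMorphism : space q ⟶ Spec (.of ℂ) :=
  Proj.toSpecZero (grading q) ≫ Spec.map (CommRingCat.ofHom (algebraMap ℂ (grading q 0)))

lemma algebraMap_zero_surjective : Function.Surjective (algebraMap ℂ (grading q 0)) := by
  rintro ⟨f, hf⟩
  refine ⟨coeff 0 f, Subtype.ext ?_⟩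
  have h1 := weightedHomogeneousComponent_zero (R := ℂ) (w := fun j => (q j : ℕ)) f
    (fun i => (q i).pos.ne')
  have h2 := weightedHomogeneousComponent_of_mem (m := 0) hf
  rw [if_pos rfl] at h2
  exact (h2.symm.trans h1).symm

instance instIsScalarTower :
    IsScalarTower ℂ (grading q 0) (MvPolynomial (Fin (n + 1)) ℂ) :=
  IsScalarTower.of_algebraMap_eq (R := ℂ) (S := grading q 0)
    (A := MvPolynomial (Fin (n + 1)) ℂ) (fun _ => rfl)

instance instFiniteType : Algebra.FiniteType (grading q 0) (MvPolynomial (Fin (n + 1)) ℂ) :=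
  Algebra.FiniteType.of_restrictScalars_finiteType ℂ _ _

instance instIsNoetherianRing : IsNoetherianRing (grading q 0) :=
  isNoetherianRing_of_surjective ℂ _ _ (algebraMap_zero_surjective q)

instance instIsLocallyNoetherian : IsLocallyNoetherian (space q) :=
  LocallyOfFiniteType.isLocallyNoetherian (Proj.toSpecZero (grading q))

instance instIsReduced : IsReduced (space q) := by
  have : ∀ i, IsReduced ((Proj.affineOpenCover (grading q)).openCover.X i) := by
    intro i
    have h : _root_.IsReduced (HomogeneousLocalization.Away (grading q)
        (i.2 : MvPolynomial (Fin (n + 1)) ℂ)) := by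
      have h0 : _root_.IsReduced (Localization.Away (i.2 : MvPolynomial (Fin (n + 1)) ℂ)) :=
        inferInstance
      exact isReduced_of_injective (algebraMap (HomogeneousLocalization.Away (grading q)
        (i.2 : MvPolynomial (Fin (n + 1)) ℂ))
        (Localization.Away (i.2 : MvPolynomial (Fin (n + 1)) ℂ)))
        (HomogeneousLocalization.val_injective _)
    exact inferInstanceAs (IsReduced (Spec (.of (HomogeneousLocalization.Away (grading q)
      (i.2 : MvPolynomial (Fin (n + 1)) ℂ)))))
  exact IsReduced.of_openCover _ (Proj.affineOpenCover (grading q)).openCover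

/-- The generic point of weighted projective space, the zero ideal. -/
def genericPt : space q where
  asHomogeneousIdeal := ⊥
  isPrime := Ideal.isPrime_bot
  not_irrelevant_le := by
    intro h
    have h0 : (X 0 : MvPolynomial (Fin (n + 1)) ℂ) ∈ HomogeneousIdeal.irrelevant (grading q) := by
      rw [HomogeneousIdeal.mem_irrelevant_iff, GradedRing.proj_apply]
      exact DirectSum.decompose_of_mem_ne (grading q)
        (isWeightedHomogeneous_X ℂ (fun j => (q j : ℕ)) 0) (q 0).pos.ne'
    exact X_ne_zero (R := ℂ) (0 : Fin (n + 1)) (h h0)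

instance instIrreducibleSpace : IrreducibleSpace (space q) := by
  have h : closure {genericPt q} = (Set.univ : Set (space q)) := by
    refine Set.eq_univ_of_forall fun x => ?_
    refine (ProjectiveSpectrum.le_iff_mem_closure (grading q) (genericPt q) x).mp ?_
    exact (bot_le : (⊥ : HomogeneousIdeal (grading q)) ≤ x.asHomogeneousIdeal)
  have h1 : IsIrreducible (Set.univ : Set (space q)) := h ▸ isIrreducible_singleton.closure
  exact { toPreirreducibleSpace := ⟨h1.2⟩, toNonempty := ⟨genericPt q⟩ }

instance instIsIntegral : IsIntegral (space q) :=
  isIntegral_of_irreducibleSpace_of_isReduced _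

/-- The prime divisor `D_j = {z_j = 0}`: coefficient `1` at the generic point of `{z_j = 0}`,
i.e. at the homogeneous prime ideal `(z_j)`, and `0` elsewhere. -/
def coordDivisor (j : Fin (n + 1)) : AlgebraicCycle (space q) ℤ :=
  open scoped Classical in
  { toFun := fun x => if x.asHomogeneousIdeal.toIdeal = Ideal.span {X j} then 1 else 0
    supportWithinDomain' := Set.subset_univ _
    supportLocallyFiniteWithinDomain' := by
      intro z _
      refine ⟨Set.univ, Filter.univ_mem, Set.Subsingleton.finite ?_⟩
      rintro x ⟨-, hx⟩ y ⟨-, hy⟩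
      have hx' : x.asHomogeneousIdeal.toIdeal = Ideal.span {X j} := by
        by_contra h
        exact hx (if_neg h)
      have hy' : y.asHomogeneousIdeal.toIdeal = Ideal.span {X j} := by
        by_contra h
        exact hy (if_neg h)
      exact ProjectiveSpectrum.ext
        (HomogeneousIdeal.toIdeal_injective (hx'.trans hy'.symm)) }

/-- The Weil divisor `∑ a_j D_j`. -/
def divisor (a : Fin (n + 1) → ℤ) : AlgebraicCycle (space q) ℤ :=
  ∑ j, a j • coordDivisor q j

/-- The degree `∑ q_j a_j` of `∑ a_j D_j`, so that `deg D_j = q_j`. -/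
def degree (a : Fin (n + 1) → ℤ) : ℤ :=
  ∑ j, (q j : ℤ) * a j

/-- A scheme over `ℂ` is projective if it admits a closed immersion over `ℂ` into some
projective space `ℙᴺ = Proj ℂ[z₀, …, z_N]`, all variables having degree one. -/
def IsProjectiveOverC {X : Scheme.{0}} (f : X ⟶ Spec (.of ℂ)) : Prop :=
  ∃ (N : ℕ) (i : X ⟶ space (fun _ : Fin (N + 1) => 1)),
    IsClosedImmersion i ∧ i ≫ structureMorphism (fun _ : Fin (N + 1) => 1) = f

end WeightedProj

end

/-!
Everything is computed inside the fraction field `K = ℂ(z₀, …, zₙ)` of the graded ring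
`A = ℂ[z₀, …, zₙ]`, a unique factorization domain. The local rings and the function field of
`P = Proj A` embed into `K`, and the nonzero rational functions on `P` become the quotients of
nonzero homogeneous polynomials of equal degree (`WeightedProj.ratFun`,
`WeightedProj.IsHomogeneousFrac`).

A prime factor of a homogeneous polynomial is homogeneous, so the points of codimension one of `P`
are the ideals `(g)` with `g` a homogeneous prime element
(`WeightedProj.exists_prime_of_coheight_eq_one`). The condition `q₀ = gcd(q₁, …, qₙ) = 1` ensures
that for each such `g` there are homogeneous fractions of every degree in which `g` does not occur
(`WeightedProj.exists_homogeneous_not_dvd`). Multiplying `g` by such a fraction of opposite degree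
gives a uniformizer of the local ring at `(g)`, and hence the order of vanishing of a rational
function along `g = 0` is the multiplicity of `g` in the fraction
(`WeightedProj.ord_eq_fracVal`). This is where well-formedness enters: in general the two numbers
differ by a factor, the ramification index.

Let `D = ∑ a_j D_j` have degree `d` and write `z ^ a = ∏ z_j ^ a_j`, a homogeneous fraction of
degree `d`. For a rational function `f ≠ 0` the coefficient of `div f + D` at `(g)` is the
multiplicity of `g` in `f z ^ a` (`WeightedProj.ord_add_divisor`), so that sections of `𝒪(D)` are
homogeneous polynomials of degree `d`.

* If every `q_j` divides `d`, then `z_j ^ (d / q_j)` defines a rational function with divisor `-D`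
  on `z_j ≠ 0`, and `D` is Cartier. Conversely, if `D` is the divisor of `f` near the `j`-th
  coordinate point, then `f⁻¹ z ^ a` is, in lowest terms, a quotient of homogeneous polynomials that
  do not vanish at that point; such polynomials contain a power of `z_j`, so `q_j` divides their
  degrees and the difference `d` (`WeightedProj.dvd_of_isCartier`).
* If moreover `d > 0`, the sections `z_j ^ (d / q_j)` have the affine nonvanishing loci `z_j ≠ 0`,
  which cover `P`, so `D` is ample. If a positive multiple of `D` has a section, then `d ≥ 0`. If
  `d = 0`, the section is a nonzero constant polynomial and its nonvanishing locus is `P`, which is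
  not affine because its global functions are constant (`WeightedProj.degree_pos_of_isAmple`).

For projectivity put `M = (n + 1) m`. A monomial whose degree is a multiple `k M` is a product of
`k` monomials of degree `M` (`WeightedProj.exists_le_weight_eq`). Sending the variables `y_i` of a
polynomial ring `B` to these monomials therefore gives a homomorphism `B → A` that multiplies
degrees by `M` and is onto in the degrees divisible by `M`. Such a homomorphism induces a closed
immersion of `Proj A` into `Proj B`, glued from the maps of degree zero localizations
(`AlgebraicGeometry.Proj.isClosedImmersion_scaledMorphism`).
-/

open AlgebraicGeometry CategoryTheory

/-! ### Factors of weighted homogeneous polynomials -/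

namespace MvPolynomial

variable {σ R : Type*} [CommRing R] (w : σ → ℕ)

/-- The homomorphism `R[z] → R[z][t]`, `z_i ↦ z_i t^{w_i}`. The coefficient of `t^k` in the
image of `p` is the component of `p` of weight `k`. -/
noncomputable def weightHom : MvPolynomial σ R →ₐ[R] Polynomial (MvPolynomial σ R) :=
  aeval fun i => Polynomial.C (X i) * Polynomial.X ^ w i

lemma weightHom_monomial (m : σ →₀ ℕ) (c : R) :
    weightHom w (monomial m c) = Polynomial.monomial (Finsupp.weight w m) (monomial m c) := by
  have h1 : (m.prod fun i k => (Polynomial.X ^ w i : Polynomial (MvPolynomial σ R)) ^ k) =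
      Polynomial.X ^ Finsupp.weight w m := by
    simp only [Finsupp.weight_apply, Finsupp.sum, Finsupp.prod, ← pow_mul, smul_eq_mul,
      Finset.prod_pow_eq_pow_sum, mul_comm (w _)]
  have h2 : (m.prod fun i k => (Polynomial.C (X i) : Polynomial (MvPolynomial σ R)) ^ k) =
      Polynomial.C (m.prod fun i k => X i ^ k) := by
    simp only [Finsupp.prod, map_prod, Polynomial.C_pow]
  have h3 : algebraMap R (Polynomial (MvPolynomial σ R)) c = Polynomial.C (C c) := rfl
  rw [weightHom, aeval_monomial, ← Polynomial.C_mul_X_pow_eq_monomial, monomial_eq (s := m), h3,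
    Polynomial.C_mul, ← h1, ← h2, mul_assoc, ← Finsupp.prod_mul]
  simp only [mul_pow]

lemma coeff_weightHom (p : MvPolynomial σ R) (k : ℕ) :
    (weightHom w p).coeff k = weightedHomogeneousComponent w k p := by
  classical
  induction p using MvPolynomial.induction_on' with
  | monomial m c =>
    rw [weightHom_monomial, Polynomial.coeff_monomial,
      weightedHomogeneousComponent_of_mem (isWeightedHomogeneous_monomial w m c rfl)]
    simp [eq_comm]
  | add p q hp hq => rw [map_add, Polynomial.coeff_add, hp, hq, map_add]

variable {w} [IsDomain R]

/-- A factor of a nonzero weighted homogeneous polynomial is weighted homogeneous: the factors of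
a monomial in `t` are monomials in `t`. -/
lemma IsWeightedHomogeneous.exists_of_mul_left {p q : MvPolynomial σ R} {d : ℕ}
    (h : IsWeightedHomogeneous w (p * q) d) (h0 : p * q ≠ 0) :
    ∃ k, IsWeightedHomogeneous w p k := by
  classical
  have key : ∀ {r : MvPolynomial σ R}, r ≠ 0 → weightHom w r ≠ 0 := by
    intro r hr h1
    obtain ⟨m, hm⟩ := ne_zero_iff.mp hr
    apply hm
    have := congrArg (fun s => coeff m (s.coeff (Finsupp.weight w m))) h1
    simpa [coeff_weightHom, coeff_weightedHomogeneousComponent] using this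
  have hp : weightHom w p ≠ 0 := key (left_ne_zero_of_mul h0)
  have hq : weightHom w q ≠ 0 := key (right_ne_zero_of_mul h0)
  have hpq : weightHom w p * weightHom w q = Polynomial.monomial d (p * q) := by
    rw [← map_mul]
    ext1 k
    rw [coeff_weightHom, weightedHomogeneousComponent_of_mem h, Polynomial.coeff_monomial]
    simp [eq_comm]
  -- The highest and the lowest exponent of `t` are additive, and they agree for the product.
  have h1 := Polynomial.natDegree_mul hp hq
  have h2 := Polynomial.natTrailingDegree_mul hp hq
  rw [hpq, Polynomial.natDegree_monomial_eq _ h0] at h1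
  rw [hpq, Polynomial.natTrailingDegree_monomial h0] at h2
  have h3 := Polynomial.natTrailingDegree_le_natDegree (weightHom w p)
  have h4 := Polynomial.natTrailingDegree_le_natDegree (weightHom w q)
  refine ⟨(weightHom w p).natDegree, fun {m} hm => ?_⟩
  have h5 : (weightHom w p).coeff (Finsupp.weight w m) ≠ 0 := by
    rw [coeff_weightHom]
    intro h6
    apply hm
    have := congrArg (coeff m) h6
    simpa [coeff_weightedHomogeneousComponent] using this
  have h7 := Polynomial.le_natDegree_of_ne_zero h5
  have h8 := Polynomial.natTrailingDegree_le_of_ne_zero h5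
  omega

end MvPolynomial

/-! ### Multiplicities in the fraction field -/

section FracVal

variable {R K : Type*} [CommRing R] [IsDomain R] [UniqueFactorizationMonoid R]
  [Field K] [Algebra R K] [IsFractionRing R K]

/-- The multiplicity of `g` in a fraction: the multiplicity in the numerator minus the one in the
denominator of a representation as a quotient. For a prime element `g` and a nonzero fraction it
does not depend on the representation. -/
noncomputable def fracVal (g : R) (x : K) : ℤ :=
  (multiplicity g (IsLocalization.sec (nonZeroDivisors R) x).1 : ℤ) -
    multiplicity g ((IsLocalization.sec (nonZeroDivisors R) x).2 : R)

variable {g : R} (hg : Prime g)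
include hg

lemma fracVal_eq {x : K} {a b : R} (ha : a ≠ 0) (hb : b ≠ 0)
    (h : x * algebraMap R K b = algebraMap R K a) :
    fracVal g x = (multiplicity g a : ℤ) - multiplicity g b := by
  have hs := IsLocalization.sec_spec (nonZeroDivisors R) x
  unfold fracVal
  set c := (IsLocalization.sec (nonZeroDivisors R) x).1
  set d := (IsLocalization.sec (nonZeroDivisors R) x).2
  have hd : (d : R) ≠ 0 := nonZeroDivisors.coe_ne_zero d
  have h1 : c * b = a * d := by
    apply IsFractionRing.injective R K
    rw [map_mul, map_mul, ← hs, ← h]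
    ring
  have hc : c ≠ 0 := by
    rintro hc
    rw [hc, zero_mul] at h1
    exact mul_ne_zero ha hd h1.symm
  have h2 := congrArg (multiplicity g) h1
  rw [multiplicity_mul hg (.of_prime_left hg (mul_ne_zero hc hb)),
    multiplicity_mul hg (.of_prime_left hg (mul_ne_zero ha hd))] at h2
  omega

lemma fracVal_algebraMap {a : R} (ha : a ≠ 0) :
    fracVal g (algebraMap R K a) = multiplicity g a := by
  rw [fracVal_eq hg ha one_ne_zero (by simp)]
  simp [multiplicity_eq_zero.mpr fun h => hg.not_isUnit (isUnit_of_dvd_one h)]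

lemma fracVal_mul {x y : K} (hx : x ≠ 0) (hy : y ≠ 0) :
    fracVal g (x * y) = fracVal g x + fracVal g y := by
  obtain ⟨a, b, hb, rfl⟩ := IsFractionRing.div_surjective (A := R) x
  obtain ⟨c, d, hd, rfl⟩ := IsFractionRing.div_surjective (A := R) y
  have hb0 := nonZeroDivisors.ne_zero hb
  have hd0 := nonZeroDivisors.ne_zero hd
  have ha0 : a ≠ 0 := by rintro rfl; simp at hx
  have hc0 : c ≠ 0 := by rintro rfl; simp at hy
  have hb1 : algebraMap R K b ≠ 0 := by simpa using hb0
  have hd1 : algebraMap R K d ≠ 0 := by simpa using hd0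
  rw [fracVal_eq (x := algebraMap R K a / algebraMap R K b) hg ha0 hb0 (by field_simp),
    fracVal_eq (x := algebraMap R K c / algebraMap R K d) hg hc0 hd0 (by field_simp),
    fracVal_eq hg (mul_ne_zero ha0 hc0) (mul_ne_zero hb0 hd0) (by
      rw [map_mul, map_mul]; field_simp),
    multiplicity_mul hg (.of_prime_left hg (mul_ne_zero ha0 hc0)),
    multiplicity_mul hg (.of_prime_left hg (mul_ne_zero hb0 hd0))]
  push_cast
  ring

lemma fracVal_one : fracVal g (1 : K) = 0 := by
  have := fracVal_mul hg (one_ne_zero (α := K)) one_ne_zero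
  rw [one_mul] at this
  omega

lemma fracVal_inv {x : K} (hx : x ≠ 0) : fracVal g x⁻¹ = - fracVal g x := by
  have := fracVal_mul hg hx (inv_ne_zero hx)
  rw [mul_inv_cancel₀ hx, fracVal_one hg] at this
  omega

lemma fracVal_pow {x : K} (hx : x ≠ 0) (n : ℕ) : fracVal g (x ^ n) = n * fracVal g x := by
  induction n with
  | zero => simp [fracVal_one hg]
  | succ n ih => rw [pow_succ, fracVal_mul hg (pow_ne_zero _ hx) hx, ih]; push_cast; ring

lemma fracVal_zpow {x : K} (hx : x ≠ 0) (n : ℤ) : fracVal g (x ^ n) = n * fracVal g x := by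
  obtain ⟨k, rfl | rfl⟩ := n.eq_nat_or_neg
  · simpa using fracVal_pow hg hx k
  · rw [zpow_neg, zpow_natCast, fracVal_inv hg (pow_ne_zero _ hx), fracVal_pow hg hx]
    ring

lemma fracVal_prod {ι : Type*} (s : Finset ι) {x : ι → K} (hx : ∀ i ∈ s, x i ≠ 0) :
    fracVal g (∏ i ∈ s, x i) = ∑ i ∈ s, fracVal g (x i) := by
  classical
  induction s using Finset.induction_on with
  | empty => simpa using fracVal_one hg
  | insert i s hi ih =>
    rw [Finset.prod_insert hi, Finset.sum_insert hi, fracVal_mul hg (hx i (by simp))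
      (Finset.prod_ne_zero_iff.mpr fun j hj => hx j (by simp [hj])),
      ih fun j hj => hx j (by simp [hj])]

end FracVal

/-! ### Local rings of `Proj` inside the fraction field -/

namespace AlgebraicGeometry.Proj

open HomogeneousLocalization

universe u

variable {A σ : Type u} [CommRing A] [IsDomain A] [SetLike σ A] [AddSubgroupClass σ A]
  (𝒜 : ℕ → σ) [GradedRing 𝒜]

lemma isUnit_algebraMap_frac (I : Ideal A) [I.IsPrime] (s : I.primeCompl) :
    IsUnit (algebraMap A (FractionRing A) s) := by
  refine IsUnit.mk0 _ ?_
  rw [Ne, FaithfulSMul.algebraMap_eq_zero_iff]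
  intro h
  exact s.2 (h ▸ zero_mem _)

/-- For a graded domain, the homogeneous localization at a prime ideal, viewed inside the
fraction field of the graded ring. -/
noncomputable def atPrimeToFrac (I : Ideal A) [I.IsPrime] : AtPrime 𝒜 I →+* FractionRing A :=
  (IsLocalization.lift (M := I.primeCompl) (S := Localization I.primeCompl)
    (isUnit_algebraMap_frac I)).comp
  (algebraMap (AtPrime 𝒜 I) (Localization I.primeCompl))

lemma atPrimeToFrac_injective (I : Ideal A) [I.IsPrime] :
    Function.Injective (atPrimeToFrac 𝒜 I) := by
  unfold atPrimeToFrac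
  rw [RingHom.coe_comp]
  refine Function.Injective.comp ?_ (val_injective _)
  rw [IsLocalization.lift_injective_iff]
  intro a b
  rw [(IsFractionRing.injective A (FractionRing A)).eq_iff,
    (IsLocalization.injective (Localization I.primeCompl)
      I.primeCompl_le_nonZeroDivisors).eq_iff]

lemma atPrimeToFrac_mk (I : Ideal A) [I.IsPrime] (c : NumDenSameDeg 𝒜 I.primeCompl) :
    atPrimeToFrac 𝒜 I (.mk c) =
      algebraMap A (FractionRing A) c.num / algebraMap A (FractionRing A) c.den := by
  have h : algebraMap A (FractionRing A) c.den ≠ 0 := by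
    rw [Ne, FaithfulSMul.algebraMap_eq_zero_iff]
    intro h
    exact c.den_mem (h ▸ zero_mem _)
  rw [eq_div_iff h, mul_comm]
  unfold atPrimeToFrac
  rw [RingHom.comp_apply, HomogeneousLocalization.algebraMap_apply, HomogeneousLocalization.val_mk,
    Localization.mk_eq_mk']
  exact ((IsLocalization.lift_mk'_spec (M := I.primeCompl) (S := Localization I.primeCompl)
    (isUnit_algebraMap_frac I) (c.num : A) _ ⟨c.den, c.den_mem⟩).mp rfl).symm

instance isPrime_asHomogeneousIdeal (y : Proj 𝒜) : y.asHomogeneousIdeal.toIdeal.IsPrime :=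
  y.isPrime

/-- The stalk of `Proj` of a graded domain, viewed inside the fraction field of the ring. -/
noncomputable def stalkToFrac (y : Proj 𝒜) : (Proj 𝒜).presheaf.stalk y →+* FractionRing A :=
  (atPrimeToFrac 𝒜 y.asHomogeneousIdeal.toIdeal).comp (stalkIso 𝒜 y).hom.hom

lemma stalkToFrac_injective (y : Proj 𝒜) : Function.Injective (stalkToFrac 𝒜 y) := by
  unfold stalkToFrac
  rw [RingHom.coe_comp]
  exact (atPrimeToFrac_injective 𝒜 _).comp (stalkIso 𝒜 y).commRingCatIsoToRingEquiv.injective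

lemma exists_of_stalkToFrac (y : Proj 𝒜) (z : (Proj 𝒜).presheaf.stalk y) :
    ∃ (k : ℕ) (F G : A), F ∈ 𝒜 k ∧ G ∈ 𝒜 k ∧ G ∉ y.asHomogeneousIdeal.toIdeal ∧
      stalkToFrac 𝒜 y z = algebraMap A (FractionRing A) F / algebraMap A (FractionRing A) G := by
  obtain ⟨c, hc⟩ := HomogeneousLocalization.mk_surjective ((stalkIso 𝒜 y).hom.hom z)
  refine ⟨c.deg, c.num, c.den, c.num.2, c.den.2, c.den_mem, ?_⟩
  rw [← atPrimeToFrac_mk, hc]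
  rfl

lemma exists_stalkToFrac_eq (y : Proj 𝒜) {k : ℕ} {F G : A} (hF : F ∈ 𝒜 k) (hG : G ∈ 𝒜 k)
    (hy : G ∉ y.asHomogeneousIdeal.toIdeal) :
    ∃ z : (Proj 𝒜).presheaf.stalk y,
      stalkToFrac 𝒜 y z = algebraMap A (FractionRing A) F / algebraMap A (FractionRing A) G := by
  refine ⟨(stalkIso 𝒜 y).inv.hom (.mk ⟨k, ⟨F, hF⟩, ⟨G, hG⟩, hy⟩), ?_⟩
  unfold stalkToFrac
  rw [RingHom.comp_apply, ← RingHom.comp_apply (stalkIso 𝒜 y).hom.hom, ← CommRingCat.hom_comp,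
    Iso.inv_hom_id, CommRingCat.hom_id, RingHom.id_apply, atPrimeToFrac_mk]

lemma stalkToFrac_germ (U : (Proj 𝒜).Opens) (y : Proj 𝒜) (hy : y ∈ U) (s : Γ(Proj 𝒜, U)) :
    stalkToFrac 𝒜 y ((Proj 𝒜).presheaf.germ U y hy s) =
      atPrimeToFrac 𝒜 y.asHomogeneousIdeal.toIdeal (s.1 ⟨y, hy⟩) := by
  unfold stalkToFrac
  rw [RingHom.comp_apply]
  exact congrArg _ (Proj.stalkIso'_germ 𝒜 U y hy s)

/-- The inclusions of the stalks into the fraction field are compatible with generization. -/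
lemma stalkToFrac_stalkSpecializes {x y : Proj 𝒜} (h : x ⤳ y)
    (z : (Proj 𝒜).presheaf.stalk y) :
    stalkToFrac 𝒜 x ((Proj 𝒜).presheaf.stalkSpecializes h z) = stalkToFrac 𝒜 y z := by
  obtain ⟨U, hyU, s, rfl⟩ := (Proj 𝒜).presheaf.exists_germ_eq z
  have hxU : x ∈ U := h.mem_open U.2 hyU
  rw [← ConcreteCategory.comp_apply, TopCat.Presheaf.germ_stalkSpecializes]
  rw [stalkToFrac_germ, stalkToFrac_germ]
  -- Near `y` the section `s` is a single fraction, which has the same value in both stalks.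
  obtain ⟨V, hyV, i, n, a, b, hb, e⟩ := s.2 ⟨y, hyU⟩
  have hxV : x ∈ V := h.mem_open V.2 hyV
  have ey := e ⟨y, hyV⟩
  have ex := e ⟨x, hxV⟩
  refine (congrArg (atPrimeToFrac 𝒜 x.asHomogeneousIdeal.toIdeal) ex).trans
    (Eq.trans ?_ (congrArg (atPrimeToFrac 𝒜 y.asHomogeneousIdeal.toIdeal) ey).symm)
  rw [atPrimeToFrac_mk, atPrimeToFrac_mk]

end AlgebraicGeometry.Proj

namespace WeightedProj

open MvPolynomial

variable {n : ℕ} (q : Fin (n + 1) → ℕ+)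

/-! ### Rational functions on weighted projective space -/

/-- The function field of weighted projective space inside `ℂ(z₀, …, zₙ)`. -/
noncomputable def ratFun :
    (space q).functionField →+* FractionRing (MvPolynomial (Fin (n + 1)) ℂ) :=
  Proj.stalkToFrac (grading q) (genericPoint (space q))

lemma ratFun_injective : Function.Injective (ratFun q) :=
  Proj.stalkToFrac_injective _ _

lemma ratFun_algebraMap (y : space q) (z : (space q).presheaf.stalk y) :
    ratFun q (algebraMap _ (space q).functionField z) = Proj.stalkToFrac (grading q) y z :=
  Proj.stalkToFrac_stalkSpecializes (grading q) _ z

lemma genericPoint_eq : genericPoint (space q) = genericPt q := by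
  apply (genericPoint_spec (space q)).eq
  refine Set.eq_univ_of_forall fun x => ?_
  refine (ProjectiveSpectrum.le_iff_mem_closure (grading q) (genericPt q) x).mp ?_
  exact (bot_le : (⊥ : HomogeneousIdeal (grading q)) ≤ x.asHomogeneousIdeal)

lemma exists_ratFun_eq {k : ℕ} {F G : MvPolynomial (Fin (n + 1)) ℂ} (hF : F ∈ grading q k)
    (hG : G ∈ grading q k) (h0 : G ≠ 0) :
    ∃ f : (space q).functionField, ratFun q f = algebraMap _ _ F / algebraMap _ _ G := by
  refine Proj.exists_stalkToFrac_eq (grading q) _ hF hG ?_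
  rw [genericPoint_eq]
  exact h0

lemma degree_eq_of_mem {k l : ℕ} {F : MvPolynomial (Fin (n + 1)) ℂ} (h0 : F ≠ 0)
    (hk : F ∈ grading q k) (hl : F ∈ grading q l) : k = l :=
  DirectSum.degree_eq_of_mem_mem (grading q) hk hl h0

lemma exists_mem_of_dvd {k : ℕ} {F G : MvPolynomial (Fin (n + 1)) ℂ} (h0 : F ≠ 0)
    (hF : F ∈ grading q k) (h : G ∣ F) : ∃ l, G ∈ grading q l := by
  obtain ⟨H, rfl⟩ := h
  exact IsWeightedHomogeneous.exists_of_mul_left hF h0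

lemma X_mem (i : Fin (n + 1)) :
    (X i : MvPolynomial (Fin (n + 1)) ℂ) ∈ grading q (q i) :=
  isWeightedHomogeneous_X ℂ _ i

/-! ### Well-formedness -/

section WellFormed

variable (hq0 : q 0 = 1)
  (hgcd : (Finset.univ : Finset (Fin n)).gcd (fun j => (q j.succ : ℕ)) = 1)

include hgcd in
lemma exists_bezout : ∃ c : Fin n → ℤ, ∑ j, (q j.succ : ℤ) * c j = 1 := by
  obtain ⟨c, hc⟩ :=
    Finset.gcd_eq_sum_mul (Finset.univ : Finset (Fin n)) fun j => (q j.succ : ℤ)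
  set G := (Finset.univ : Finset (Fin n)).gcd fun j => (q j.succ : ℤ)
  have h1 : G.natAbs ∣ 1 := by
    rw [← hgcd]
    refine Finset.dvd_gcd fun j hj => ?_
    have := Finset.gcd_dvd (f := fun j => (q j.succ : ℤ)) hj
    exact Int.natAbs_dvd_natAbs.mpr this
  have h2 : G.natAbs = 1 := Nat.dvd_one.mp h1
  rcases Int.natAbs_eq G with h | h
  · exact ⟨c, by rw [← hc, h, h2]; rfl⟩
  · refine ⟨fun j => - c j, ?_⟩
    simp only [mul_neg, Finset.sum_neg_distrib, ← hc]
    rw [h, h2]; rfl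

include hq0 hgcd in
/-- For a prime `g` there are homogeneous polynomials of degrees `k` and `k + e` not divisible by
`g`: one can take `1` and a power of `z₀`, or, if `g` is `z₀` up to a unit, suitable monomials in
`z₁, …, zₙ`, since the degrees of these variables are coprime. -/
lemma exists_homogeneous_not_dvd {g : MvPolynomial (Fin (n + 1)) ℂ} (hg : Prime g) (e : ℕ) :
    ∃ (k : ℕ) (H₁ H₂ : MvPolynomial (Fin (n + 1)) ℂ), H₁ ∈ grading q k ∧
      H₂ ∈ grading q (k + e) ∧ ¬ g ∣ H₁ ∧ ¬ g ∣ H₂ := by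
  by_cases h : g ∣ X 0
  · obtain ⟨c, hc⟩ := exists_bezout q hgcd
    have hX : Associated g (X 0) := hg.associated_of_dvd (X_prime ..) h
    have hn : ∀ (b : Fin n → ℕ), ¬ g ∣ ∏ j, X (R := ℂ) (Fin.succ j) ^ b j := by
      intro b hb
      obtain ⟨j, -, hj⟩ := (Prime.dvd_finsetProd_iff hg _).mp hb
      have h1 : (X 0 : MvPolynomial (Fin (n + 1)) ℂ) ∣ X j.succ :=
        hX.symm.dvd.trans (hg.dvd_of_dvd_pow hj)
      rw [X_dvd_X] at h1
      exact (Fin.succ_ne_zero j) (by simpa using h1.symm)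
    have hm : ∀ (b : Fin n → ℕ), ∏ j, X (R := ℂ) (Fin.succ j) ^ b j ∈
        grading q (∑ j, b j * (q j.succ : ℕ)) := by
      intro b
      refine IsWeightedHomogeneous.prod _ _ _ fun j _ => ?_
      simpa using (isWeightedHomogeneous_X ℂ (fun j => (q j : ℕ)) j.succ).pow (b j)
    -- The positive and the negative part of a Bézout relation `∑ q_j c_j = 1`, multiplied by `e`.
    refine ⟨_, _, _, hm fun j => e * (- c j).toNat, ?_, hn _, hn fun j => e * (c j).toNat⟩
    convert hm _ using 2
    have h3 (j : Fin n) : ((c j).toNat : ℤ) - (- c j).toNat = c j := by omega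
    have h2 : (e : ℤ) = ∑ j, (e : ℤ) * (q j.succ * ((c j).toNat - (- c j).toNat)) := by
      simp only [h3, ← Finset.mul_sum, hc, mul_one]
    have h4 : (((∑ j, e * (- c j).toNat * (q j.succ : ℕ)) + e : ℕ) : ℤ) =
        (∑ j, e * (c j).toNat * (q j.succ : ℕ) : ℕ) := by
      push_cast
      rw [← eq_sub_iff_add_eq', ← Finset.sum_sub_distrib]
      refine h2.trans (Finset.sum_congr rfl fun j _ => ?_)
      ring
    exact_mod_cast h4
  · refine ⟨0, 1, X 0 ^ e, SetLike.GradedOne.one_mem, ?_, ?_, ?_⟩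
    · have := SetLike.pow_mem_graded e (X_mem q 0)
      simpa [hq0] using this
    · exact fun h => hg.not_isUnit (isUnit_of_dvd_one h)
    · exact fun h1 => h (hg.dvd_of_dvd_pow h1)

end WellFormed

end WeightedProj

namespace WeightedProj

open MvPolynomial

variable {n : ℕ} (q : Fin (n + 1) → ℕ+)

/-! ### Points of codimension one -/

lemma le_of_specializes {x y : space q} (h : x ⤳ y) :
    x.asHomogeneousIdeal.toIdeal ≤ y.asHomogeneousIdeal.toIdeal :=
  (ProjectiveSpectrum.le_iff_mem_closure (grading q) x y).mpr h.mem_closure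

lemma specializes_of_le {x y : space q}
    (h : x.asHomogeneousIdeal.toIdeal ≤ y.asHomogeneousIdeal.toIdeal) : x ⤳ y :=
  specializes_iff_mem_closure.mpr <|
    (ProjectiveSpectrum.le_iff_mem_closure (grading q) x y).mp h

lemma eq_of_toIdeal_eq {x y : space q}
    (h : x.asHomogeneousIdeal.toIdeal = y.asHomogeneousIdeal.toIdeal) : x = y :=
  ProjectiveSpectrum.ext (HomogeneousIdeal.toIdeal_injective h)

lemma coe_decompose (F : MvPolynomial (Fin (n + 1)) ℂ) (k : ℕ) :
    (DirectSum.decompose (grading q) F k : MvPolynomial (Fin (n + 1)) ℂ) =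
      weightedHomogeneousComponent (fun j => (q j : ℕ)) k F :=
  weightedDecomposition.decompose'_apply ℂ _ F k

lemma exists_X_notMem (x : space q) :
    ∃ i, (X i : MvPolynomial (Fin (n + 1)) ℂ) ∉ x.asHomogeneousIdeal.toIdeal := by
  by_contra! h
  refine x.not_irrelevant_le fun F hF => ?_
  have h0 : coeff 0 F = 0 := by
    rw [HomogeneousIdeal.mem_irrelevant_iff, GradedRing.proj_apply, coe_decompose] at hF
    have := congrArg (coeff 0) hF
    simpa [coeff_weightedHomogeneousComponent] using this
  have h1 : Ideal.span (X '' Set.univ) ≤ x.asHomogeneousIdeal.toIdeal := by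
    rw [Ideal.span_le]
    rintro _ ⟨i, -, rfl⟩
    exact h i
  apply h1
  rw [mem_ideal_span_X_image]
  intro m hm
  have hm0 : m ≠ 0 := by
    rintro rfl
    exact (mem_support_iff.mp hm) h0
  obtain ⟨i, hi⟩ := Finsupp.ne_iff.mp hm0
  exact ⟨i, trivial, hi⟩

/-- A nonzero homogeneous prime ideal contains a homogeneous prime element dividing a given
nonzero homogeneous member. -/
lemma exists_prime_dvd_of_mem {I : Ideal (MvPolynomial (Fin (n + 1)) ℂ)} [I.IsPrime] {k : ℕ}
    {F : MvPolynomial (Fin (n + 1)) ℂ} (hF : F ∈ grading q k) (h0 : F ≠ 0) (h : F ∈ I) :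
    ∃ (e : ℕ) (g : MvPolynomial (Fin (n + 1)) ℂ),
      Prime g ∧ g ∈ grading q e ∧ g ∈ I ∧ g ∣ F := by
  obtain ⟨s, hs, u, hu⟩ := UniqueFactorizationMonoid.exists_prime_factors F h0
  have h1 : s.prod ∈ I := by
    rw [← hu] at h
    exact (I.mul_unit_mem_iff_mem u.isUnit).mp h
  obtain ⟨g, hgs, hgI⟩ := (Ideal.IsPrime.multiset_prod_mem_iff_exists_mem ‹I.IsPrime› s).mp h1
  have h2 : g ∣ F := (Multiset.dvd_prod hgs).trans (hu ▸ Dvd.intro _ rfl)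
  obtain ⟨e, he⟩ := exists_mem_of_dvd q h0 hF h2
  exact ⟨e, g, hs g hgs, he, hgI, h2⟩

lemma not_dvd_X_of_dvd_X {g : MvPolynomial (Fin (n + 1)) ℂ} (hg : Prime g) {i j : Fin (n + 1)}
    (hij : i ≠ j) (hi : g ∣ X i) : ¬ g ∣ X j := by
  intro hj
  have h1 : Associated g (X i) := hg.associated_of_dvd (X_prime ..) hi
  have h2 : (X i : MvPolynomial (Fin (n + 1)) ℂ) ∣ X j := h1.symm.dvd.trans hj
  rw [X_dvd_X] at h2
  exact hij (by simpa using h2)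

/-- The point of weighted projective space given by a homogeneous prime polynomial. In dimension
zero the prime `z₀` generates the irrelevant ideal, hence the assumption `n ≠ 0`. -/
noncomputable def primePt [NeZero n] {e : ℕ} {g : MvPolynomial (Fin (n + 1)) ℂ} (hg : Prime g)
    (he : g ∈ grading q e) : space q where
  asHomogeneousIdeal := ⟨Ideal.span {g}, Ideal.homogeneous_span _ _ (by
    rintro _ rfl
    exact ⟨e, he⟩)⟩
  isPrime := (Ideal.span_singleton_prime hg.ne_zero).mpr hg
  not_irrelevant_le h := by
    have h1 (i : Fin (n + 1)) : g ∣ X i := by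
      rw [← Ideal.mem_span_singleton]
      refine h ?_
      rw [HomogeneousIdeal.mem_irrelevant_iff, GradedRing.proj_apply]
      exact DirectSum.decompose_of_mem_ne (grading q) (X_mem q i) (q i).pos.ne'
    refine not_dvd_X_of_dvd_X hg (i := 0) (j := Fin.last n) ?_ (h1 _) (h1 _)
    exact fun h2 => NeZero.ne n (by simpa using (congrArg Fin.val h2).symm)

lemma primePt_toIdeal [NeZero n] {e : ℕ} {g : MvPolynomial (Fin (n + 1)) ℂ} (hg : Prime g)
    (he : g ∈ grading q e) : (primePt q hg he).asHomogeneousIdeal.toIdeal = Ideal.span {g} := rfl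

/-- The points of codimension one are given by homogeneous prime elements: the ideal of such a point
contains a homogeneous prime element `g`, and if it were larger than `(g)`, the chain of `0`, `(g)`
and this ideal would show that the codimension is at least two. -/
lemma exists_prime_of_coheight_eq_one [NeZero n] {y : space q} (hy : Order.coheight y = 1) :
    ∃ (e : ℕ) (g : MvPolynomial (Fin (n + 1)) ℂ), Prime g ∧ g ∈ grading q e ∧
      y.asHomogeneousIdeal.toIdeal = Ideal.span {g} := by
  have h1 : ∃ F ∈ y.asHomogeneousIdeal.toIdeal,
      SetLike.IsHomogeneousElem (grading q) F ∧ F ≠ 0 := by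
    by_contra! h
    have h2 : y = genericPt q := by
      apply eq_of_toIdeal_eq
      refine le_antisymm ?_ bot_le
      obtain ⟨S, hS⟩ := (Ideal.IsHomogeneous.iff_exists _ _).mp y.asHomogeneousIdeal.2
      have hS' : y.asHomogeneousIdeal.toIdeal = Ideal.span (Subtype.val '' S) := hS
      rw [hS', Ideal.span_le]
      rintro _ ⟨F, hF, rfl⟩
      exact h F (hS' ▸ Ideal.subset_span ⟨F, hF, rfl⟩) F.2
    have h3 : Order.coheight y = 0 := by
      rw [Order.coheight_eq_zero, h2]
      intro z _
      exact specializes_of_le q bot_le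
    rw [h3] at hy
    exact zero_ne_one hy
  obtain ⟨F, hFy, ⟨k, hk⟩, hF0⟩ := h1
  obtain ⟨e, g, hg, he, hgy, -⟩ := exists_prime_dvd_of_mem q hk hF0 hFy
  refine ⟨e, g, hg, he, ?_⟩
  have hle : Ideal.span {g} ≤ y.asHomogeneousIdeal.toIdeal := by
    rwa [Ideal.span_singleton_le_iff_mem]
  by_contra hne
  have hlt : y < primePt q hg he := by
    refine lt_of_le_not_ge (specializes_of_le q hle) fun h => hne ?_
    exact le_antisymm (le_of_specializes q h) hle
  have hlt' : primePt q hg he < genericPt q := by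
    refine lt_of_le_not_ge (specializes_of_le q bot_le) fun h => hg.ne_zero ?_
    exact le_of_specializes q h (Ideal.mem_span_singleton_self g)
  have h4 := Order.coheight_add_one_le hlt
  have h5 := Order.coheight_add_one_le hlt'
  have : (2 : ℕ∞) ≤ 1 := by
    calc (2 : ℕ∞) = 0 + 1 + 1 := by norm_num
      _ ≤ Order.coheight (genericPt q) + 1 + 1 := by gcongr; exact zero_le
      _ ≤ Order.coheight (primePt q hg he) + 1 := by gcongr
      _ ≤ 1 := h4.trans hy.le
  exact absurd this (by norm_num)

end WeightedProj

namespace WeightedProj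

open MvPolynomial

variable {n : ℕ} (q : Fin (n + 1) → ℕ+)

/-! ### The order of vanishing at a prime divisor -/

lemma algebraMap_frac_ne_zero {F : MvPolynomial (Fin (n + 1)) ℂ} (h : F ≠ 0) :
    algebraMap (MvPolynomial (Fin (n + 1)) ℂ)
      (FractionRing (MvPolynomial (Fin (n + 1)) ℂ)) F ≠ 0 := by
  rwa [Ne, FaithfulSMul.algebraMap_eq_zero_iff]

/-- A quotient of homogeneous polynomials of equal degree that both do not vanish at `y` is a unit
of the local ring at `y`. -/
lemma isUnit_stalk {y : space q} {k : ℕ} {F G : MvPolynomial (Fin (n + 1)) ℂ}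
    (hF : F ∈ grading q k) (hG : G ∈ grading q k) (hFy : F ∉ y.asHomogeneousIdeal.toIdeal)
    (hGy : G ∉ y.asHomogeneousIdeal.toIdeal) {z : (space q).presheaf.stalk y}
    (hz : Proj.stalkToFrac (grading q) y z = algebraMap _ _ F / algebraMap _ _ G) : IsUnit z := by
  obtain ⟨z', hz'⟩ := Proj.exists_stalkToFrac_eq (grading q) y hG hF hFy
  refine IsUnit.of_mul_eq_one z' (Proj.stalkToFrac_injective (grading q) y ?_)
  have hF0 := algebraMap_frac_ne_zero (F := F) fun h => hFy (h ▸ zero_mem _)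
  have hG0 := algebraMap_frac_ne_zero (F := G) fun h => hGy (h ▸ zero_mem _)
  rw [map_mul, map_one, hz, hz']
  field_simp

section Ord

variable {q} {y : space q} {g : MvPolynomial (Fin (n + 1)) ℂ}

/-- At the prime divisor `g = 0`, an element of the local ring whose fraction is `g H₁ / H₂`, with
`H₁`, `H₂` not divisible by `g`, generates the maximal ideal. -/
lemma maximalIdeal_eq_span {e : ℕ} (hg : Prime g) (he : g ∈ grading q e)
    (hy : y.asHomogeneousIdeal.toIdeal = Ideal.span {g}) {k : ℕ}
    {H₁ H₂ : MvPolynomial (Fin (n + 1)) ℂ} (h₁ : H₁ ∈ grading q k) (h₂ : H₂ ∈ grading q (k + e))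
    (hd₁ : ¬ g ∣ H₁) (hd₂ : ¬ g ∣ H₂) {π : (space q).presheaf.stalk y}
    (hπ : Proj.stalkToFrac (grading q) y π = algebraMap _ _ (g * H₁) / algebraMap _ _ H₂) :
    IsLocalRing.maximalIdeal ((space q).presheaf.stalk y) = Ideal.span {π} := by
  have hmem (F : MvPolynomial (Fin (n + 1)) ℂ) :
      F ∈ y.asHomogeneousIdeal.toIdeal ↔ g ∣ F := by rw [hy, Ideal.mem_span_singleton]
  have hne {F : MvPolynomial (Fin (n + 1)) ℂ} (h : ¬ g ∣ F) :=
    algebraMap_frac_ne_zero (F := F) fun h0 => h (h0 ▸ dvd_zero g)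
  apply le_antisymm
  · intro z hz
    rw [Ideal.mem_span_singleton]
    obtain ⟨l, F, G, hF, hG, hGy, hFG⟩ := Proj.exists_of_stalkToFrac (grading q) y z
    have hgF : g ∣ F := by
      by_contra h
      exact (IsLocalRing.mem_maximalIdeal _).mp hz
        (isUnit_stalk q hF hG ((hmem F).not.mpr h) hGy hFG)
    obtain ⟨F', rfl⟩ := hgF
    by_cases h0 : g * F' = 0
    · rw [h0, map_zero, zero_div] at hFG
      rw [(map_eq_zero_iff _ (Proj.stalkToFrac_injective (grading q) y)).mp hFG]
      exact dvd_zero π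
    obtain ⟨r, hr⟩ := exists_mem_of_dvd q h0 hF (Dvd.intro_left g rfl)
    have hl := degree_eq_of_mem q h0 hF (SetLike.mul_mem_graded he hr)
    have hn : F' * H₂ ∈ grading q (l + k) := by
      have := SetLike.mul_mem_graded hr h₂
      rwa [show r + (k + e) = l + k by omega] at this
    obtain ⟨w, hw⟩ := Proj.exists_stalkToFrac_eq (grading q) y hn (SetLike.mul_mem_graded hG h₁)
      ((hmem _).not.mpr fun h => (hg.dvd_or_dvd h).elim ((hmem G).not.mp hGy) hd₁)
    refine ⟨w, Proj.stalkToFrac_injective (grading q) y ?_⟩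
    have n1 := hne hd₁
    have n2 := hne hd₂
    have n3 := hne ((hmem G).not.mp hGy)
    rw [map_mul, hπ, hw, hFG]
    simp only [map_mul]
    field_simp
  · rw [Ideal.span_singleton_le_iff_mem, IsLocalRing.mem_maximalIdeal, mem_nonunits_iff]
    intro hu
    obtain ⟨w, hw⟩ := hu.exists_right_inv
    obtain ⟨l, F, G, hF, hG, hGy, hFG⟩ := Proj.exists_of_stalkToFrac (grading q) y w
    have n2 := hne hd₂
    have n3 := hne ((hmem G).not.mp hGy)
    have h1 := congrArg (Proj.stalkToFrac (grading q) y) hw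
    rw [map_mul, map_one, hπ, hFG] at h1
    field_simp at h1
    rw [← map_mul, ← map_mul] at h1
    have h2 := IsFractionRing.injective _ _ h1
    have h3 : g ∣ H₂ * G := ⟨H₁ * F, by rw [← h2]; ring⟩
    exact (hg.dvd_or_dvd h3).elim hd₂ ((hmem G).not.mp hGy)

variable (hq0 : q 0 = 1)
  (hgcd : (Finset.univ : Finset (Fin n)).gcd (fun j => (q j.succ : ℕ)) = 1)

include hq0 hgcd

/-- The local ring at the prime divisor `g = 0` is a discrete valuation ring. -/
lemma exists_uniformizer {e : ℕ} (hg : Prime g) (he : g ∈ grading q e)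
    (hy : y.asHomogeneousIdeal.toIdeal = Ideal.span {g}) :
    IsDiscreteValuationRing ((space q).presheaf.stalk y) ∧
    ∃ π : (space q).presheaf.stalk y, Irreducible π ∧
      fracVal g (Proj.stalkToFrac (grading q) y π) = 1 := by
  obtain ⟨k, H₁, H₂, h₁, h₂, hd₁, hd₂⟩ := exists_homogeneous_not_dvd q hq0 hgcd hg e
  have hmem (F : MvPolynomial (Fin (n + 1)) ℂ) :
      F ∈ y.asHomogeneousIdeal.toIdeal ↔ g ∣ F := by rw [hy, Ideal.mem_span_singleton]
  have h₃ : g * H₁ ∈ grading q (k + e) := add_comm e k ▸ SetLike.mul_mem_graded he h₁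
  obtain ⟨π, hπ⟩ := Proj.exists_stalkToFrac_eq (grading q) y h₃ h₂ ((hmem _).not.mpr hd₂)
  have hmax := maximalIdeal_eq_span hg he hy h₁ h₂ hd₁ hd₂ hπ
  have n1 : H₁ ≠ 0 := fun h => hd₁ (h ▸ dvd_zero g)
  have n2 : H₂ ≠ 0 := fun h => hd₂ (h ▸ dvd_zero g)
  have n2' := algebraMap_frac_ne_zero n2
  have hπ0 : π ≠ 0 := by
    rintro rfl
    rw [map_zero, eq_comm, div_eq_zero_iff] at hπ
    refine hπ.elim (fun h => ?_) n2'
    rw [FaithfulSMul.algebraMap_eq_zero_iff] at h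
    exact mul_ne_zero hg.ne_zero n1 h
  have hfield : ¬ IsField ((space q).presheaf.stalk y) := by
    rw [IsLocalRing.isField_iff_maximalIdeal_eq, hmax]
    simpa using hπ0
  have hdvr : IsDiscreteValuationRing ((space q).presheaf.stalk y) := by
    have h := (IsDiscreteValuationRing.TFAE ((space q).presheaf.stalk y) hfield).out 0 4
    rw [h, hmax]
    exact ⟨π, rfl⟩
  refine ⟨hdvr, π, (IsDiscreteValuationRing.irreducible_iff_uniformizer π).mpr hmax, ?_⟩
  rw [hπ, fracVal_eq hg (mul_ne_zero hg.ne_zero n1) n2 (by field_simp),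
    multiplicity_mul hg (.of_prime_left hg (mul_ne_zero hg.ne_zero n1)),
    multiplicity_eq_zero.mpr hd₁, multiplicity_eq_zero.mpr hd₂]
  simp [multiplicity_self]

lemma coheight_eq_one {e : ℕ} (hg : Prime g) (he : g ∈ grading q e)
    (hy : y.asHomogeneousIdeal.toIdeal = Ideal.span {g}) : Order.coheight y = 1 := by
  obtain ⟨_, -⟩ := exists_uniformizer hq0 hgcd hg he hy
  have := ringKrullDim_stalk_eq_coheight y
  rw [IsDiscreteValuationRing.ringKrullDim_eq_one] at this
  exact_mod_cast this.symm

/-- The order of vanishing along the prime divisor `g = 0` is the multiplicity of `g`. -/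
lemma ord_eq_fracVal {e : ℕ} (hg : Prime g) (he : g ∈ grading q e)
    (hy : y.asHomogeneousIdeal.toIdeal = Ideal.span {g}) {f : (space q).functionField}
    (hf : f ≠ 0) : Scheme.ord f y = fracVal g (ratFun q f) := by
  obtain ⟨hdvr, π, hπ, hπv⟩ := exists_uniformizer hq0 hgcd hg he hy
  have hco := coheight_eq_one hq0 hgcd hg he hy
  have hne {z : (space q).presheaf.stalk y} (hz : z ≠ 0) :
      Proj.stalkToFrac (grading q) y z ≠ 0 := by
    rwa [Ne, map_eq_zero_iff _ (Proj.stalkToFrac_injective (grading q) y)]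
  have hnonneg {z : (space q).presheaf.stalk y} (hz : z ≠ 0) :
      0 ≤ fracVal g (Proj.stalkToFrac (grading q) y z) := by
    obtain ⟨l, F, G, hF, hG, hGy, hFG⟩ := Proj.exists_of_stalkToFrac (grading q) y z
    have hG0 : G ≠ 0 := fun h => hGy (h ▸ zero_mem _)
    have hG0' := algebraMap_frac_ne_zero hG0
    have hF0 : F ≠ 0 := by
      rintro rfl
      rw [map_zero, zero_div] at hFG
      exact hne hz hFG
    rw [hy, Ideal.mem_span_singleton] at hGy
    rw [hFG, fracVal_eq hg hF0 hG0 (by field_simp), multiplicity_eq_zero.mpr hGy]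
    simp
  have hunit {z : (space q).presheaf.stalk y} (hz : IsUnit z) :
      fracVal g (Proj.stalkToFrac (grading q) y z) = 0 := by
    obtain ⟨w, hw⟩ := hz.exists_right_inv
    have hz0 : z ≠ 0 := left_ne_zero_of_mul_eq_one hw
    have hw0 : w ≠ 0 := right_ne_zero_of_mul_eq_one hw
    have h1 := congrArg (fun z => fracVal g (Proj.stalkToFrac (grading q) y z)) hw
    simp only [map_mul, map_one] at h1
    rw [fracVal_mul hg (hne hz0) (hne hw0), fracVal_one hg] at h1
    have := hnonneg hz0
    have := hnonneg hw0
    omega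
  have hinj := IsFractionRing.injective ((space q).presheaf.stalk y) (space q).functionField
  -- Elements of the local ring are units times powers of the uniformizer, for which both sides
  -- are the exponent; fractions of them follow by additivity.
  have hint (z : (space q).presheaf.stalk y) (hz : z ≠ 0) :
      Scheme.ord (algebraMap _ (space q).functionField z) y =
        fracVal g (Proj.stalkToFrac (grading q) y z) := by
    obtain ⟨m, u, rfl⟩ := IsDiscreteValuationRing.eq_unit_mul_pow_irreducible hz hπ
    have h0 : algebraMap ((space q).presheaf.stalk y) (space q).functionField (u * π ^ m) ≠ 0 := by
      rwa [Ne, map_eq_zero_iff _ hinj]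
    rw [Scheme.ord_eq_iff hco h0, map_mul (Proj.stalkToFrac (grading q) y),
      fracVal_mul hg (hne u.ne_zero) (hne (pow_ne_zero _ hπ.ne_zero)), hunit u.isUnit, map_pow,
      fracVal_pow hg (hne hπ.ne_zero), hπv, zero_add, mul_one]
    have := krullDimLE_of_coheight_le hco.le
    unfold Scheme.ordHom
    rw [map_mul, map_mul, Ring.ordFrac_of_isUnit u.isUnit, map_pow, map_pow,
      Ring.ordFrac_irreducible hπ, one_mul, ← WithZero.exp_nsmul, nsmul_eq_mul, mul_one]
    rfl
  obtain ⟨a, b, hb, rfl⟩ := IsFractionRing.div_surjective (A := (space q).presheaf.stalk y) f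
  have hb0 : b ≠ 0 := nonZeroDivisors.ne_zero hb
  have ha0 : a ≠ 0 := by
    rintro rfl
    simp at hf
  have hb1 : algebraMap ((space q).presheaf.stalk y) (space q).functionField b ≠ 0 := by
    rwa [Ne, map_eq_zero_iff _ hinj]
  have h1 := Scheme.ord_mul (x := y) hf hb1
  rw [div_mul_cancel₀ _ hb1, hint a ha0, hint b hb0] at h1
  rw [map_div₀, ratFun_algebraMap, ratFun_algebraMap,
    div_eq_mul_inv (Proj.stalkToFrac (grading q) y a),
    fracVal_mul hg (hne ha0) (inv_ne_zero (hne hb0)), fracVal_inv hg (hne hb0)]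
  omega

end Ord

end WeightedProj

namespace WeightedProj

open MvPolynomial

variable {n : ℕ} (q : Fin (n + 1) → ℕ+)

/-! ### Homogeneous fractions -/

/-- `x` is a quotient of nonzero homogeneous polynomials whose degrees differ by `d`. -/
def IsHomogeneousFrac (x : FractionRing (MvPolynomial (Fin (n + 1)) ℂ)) (d : ℤ) : Prop :=
  ∃ (k l : ℕ) (F G : MvPolynomial (Fin (n + 1)) ℂ), F ∈ grading q k ∧ G ∈ grading q l ∧
    F ≠ 0 ∧ G ≠ 0 ∧ (k : ℤ) - l = d ∧ x = algebraMap _ _ F / algebraMap _ _ G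

variable {q}

namespace IsHomogeneousFrac

variable {x y : FractionRing (MvPolynomial (Fin (n + 1)) ℂ)} {d e : ℤ}

lemma ne_zero (hx : IsHomogeneousFrac q x d) : x ≠ 0 := by
  obtain ⟨k, l, F, G, -, -, hF0, hG0, -, rfl⟩ := hx
  exact div_ne_zero (algebraMap_frac_ne_zero hF0) (algebraMap_frac_ne_zero hG0)

lemma of_mem {k : ℕ} {F : MvPolynomial (Fin (n + 1)) ℂ} (hF : F ∈ grading q k) (h0 : F ≠ 0) :
    IsHomogeneousFrac q (algebraMap _ _ F) k :=
  ⟨k, 0, F, 1, hF, SetLike.GradedOne.one_mem, h0, one_ne_zero, by simp, by simp⟩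

lemma mul (hx : IsHomogeneousFrac q x d) (hy : IsHomogeneousFrac q y e) :
    IsHomogeneousFrac q (x * y) (d + e) := by
  obtain ⟨k, l, F, G, hF, hG, hF0, hG0, rfl, rfl⟩ := hx
  obtain ⟨k', l', F', G', hF', hG', hF0', hG0', rfl, rfl⟩ := hy
  refine ⟨_, _, _, _, SetLike.mul_mem_graded hF hF', SetLike.mul_mem_graded hG hG',
    mul_ne_zero hF0 hF0', mul_ne_zero hG0 hG0', ?_, ?_⟩
  · push_cast; ring
  · rw [map_mul, map_mul, div_mul_div_comm]

lemma inv (hx : IsHomogeneousFrac q x d) : IsHomogeneousFrac q x⁻¹ (-d) := by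
  obtain ⟨k, l, F, G, hF, hG, hF0, hG0, rfl, rfl⟩ := hx
  exact ⟨l, k, G, F, hG, hF, hG0, hF0, by ring, by rw [inv_div]⟩

lemma one : IsHomogeneousFrac q 1 0 :=
  ⟨0, 0, 1, 1, SetLike.GradedOne.one_mem, SetLike.GradedOne.one_mem, one_ne_zero, one_ne_zero,
    by simp, by simp⟩

lemma pow (hx : IsHomogeneousFrac q x d) (m : ℕ) : IsHomogeneousFrac q (x ^ m) (m * d) := by
  induction m with
  | zero => simpa using one
  | succ m ih =>
    rw [pow_succ, show ((m + 1 : ℕ) : ℤ) * d = m * d + d by push_cast; ring]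
    exact ih.mul hx

lemma zpow (hx : IsHomogeneousFrac q x d) (m : ℤ) : IsHomogeneousFrac q (x ^ m) (m * d) := by
  obtain ⟨k, rfl | rfl⟩ := m.eq_nat_or_neg
  · simpa using hx.pow k
  · simpa using (hx.pow k).inv

lemma prod {ι : Type*} (s : Finset ι) {x : ι → FractionRing (MvPolynomial (Fin (n + 1)) ℂ)}
    {d : ι → ℤ} (hx : ∀ i ∈ s, IsHomogeneousFrac q (x i) (d i)) :
    IsHomogeneousFrac q (∏ i ∈ s, x i) (∑ i ∈ s, d i) := by
  classical
  induction s using Finset.induction_on with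
  | empty => simpa using one
  | insert i s hi ih =>
    rw [Finset.prod_insert hi, Finset.sum_insert hi]
    exact (hx i (by simp)).mul (ih fun j hj => hx j (by simp [hj]))

/-- Homogeneous fractions of degree zero are the nonzero rational functions. -/
lemma exists_ratFun_eq (hx : IsHomogeneousFrac q x 0) :
    ∃ f : (space q).functionField, f ≠ 0 ∧ ratFun q f = x := by
  have hx0 := hx.ne_zero
  obtain ⟨k, l, F, G, hF, hG, hF0, hG0, hd, rfl⟩ := hx
  obtain rfl : k = l := by omega
  obtain ⟨f, hf⟩ := WeightedProj.exists_ratFun_eq q hF hG hG0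
  refine ⟨f, ?_, hf⟩
  rintro rfl
  exact hx0 (by rw [← hf, map_zero])

lemma ratFun {f : (space q).functionField} (hf : f ≠ 0) :
    IsHomogeneousFrac q (ratFun q f) 0 := by
  obtain ⟨k, F, G, hF, hG, hGy, hFG⟩ := Proj.exists_of_stalkToFrac (grading q) _ f
  have hG0 : G ≠ 0 := fun h => hGy (h ▸ zero_mem _)
  refine ⟨k, k, F, G, hF, hG, ?_, hG0, by simp, hFG⟩
  rintro rfl
  rw [map_zero, zero_div] at hFG
  exact hf ((map_eq_zero_iff _ (ratFun_injective q)).mp hFG)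

/-- A homogeneous fraction is a quotient of coprime homogeneous polynomials. -/
lemma exists_isRelPrime (hx : IsHomogeneousFrac q x d) :
    ∃ (k l : ℕ) (F G : MvPolynomial (Fin (n + 1)) ℂ), F ∈ grading q k ∧ G ∈ grading q l ∧
      F ≠ 0 ∧ G ≠ 0 ∧ (k : ℤ) - l = d ∧ x = algebraMap _ _ F / algebraMap _ _ G ∧
      IsRelPrime F G := by
  obtain ⟨k, l, F, G, hF, hG, hF0, hG0, rfl, rfl⟩ := hx
  obtain ⟨F', G', c, hrel, rfl, rfl⟩ := UniqueFactorizationMonoid.exists_reduced_factors F hF0 G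
  have hc0 := left_ne_zero_of_mul hF0
  have hF0' := right_ne_zero_of_mul hF0
  have hG0' := right_ne_zero_of_mul hG0
  obtain ⟨m, hm⟩ := exists_mem_of_dvd q hF0 hF (Dvd.intro _ rfl)
  obtain ⟨k', hk⟩ := exists_mem_of_dvd q hF0 hF (Dvd.intro_left _ rfl)
  obtain ⟨l', hl⟩ := exists_mem_of_dvd q hG0 hG (Dvd.intro_left _ rfl)
  have h1 := degree_eq_of_mem q hF0 hF (SetLike.mul_mem_graded hm hk)
  have h2 := degree_eq_of_mem q hG0 hG (SetLike.mul_mem_graded hm hl)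
  refine ⟨k', l', F', G', hk, hl, hF0', hG0', by omega, ?_, hrel⟩
  have := algebraMap_frac_ne_zero hc0
  have := algebraMap_frac_ne_zero hG0'
  rw [map_mul, map_mul]
  field_simp

end IsHomogeneousFrac

lemma fracVal_pos_of_isRelPrime {F G g : MvPolynomial (Fin (n + 1)) ℂ} (hF : F ≠ 0) (hG : G ≠ 0)
    (h : IsRelPrime F G) (hg : Prime g) (hgF : g ∣ F) :
    0 < fracVal g (algebraMap _ (FractionRing (MvPolynomial (Fin (n + 1)) ℂ)) F /
      algebraMap _ _ G) := by
  have := algebraMap_frac_ne_zero hG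
  rw [fracVal_eq hg hF hG (by field_simp),
    multiplicity_eq_zero.mpr fun h' => hg.not_isUnit (h hgF h')]
  have := ((FiniteMultiplicity.of_prime_left hg hF).pow_dvd_iff_le_multiplicity (k := 1)).mp
    (by simpa using hgF)
  omega

lemma fracVal_neg_of_isRelPrime {F G g : MvPolynomial (Fin (n + 1)) ℂ} (hF : F ≠ 0) (hG : G ≠ 0)
    (h : IsRelPrime F G) (hg : Prime g) (hgG : g ∣ G) :
    fracVal g (algebraMap _ (FractionRing (MvPolynomial (Fin (n + 1)) ℂ)) F /
      algebraMap _ _ G) < 0 := by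
  have := fracVal_pos_of_isRelPrime hG hF h.symm hg hgG
  rw [← inv_div, fracVal_inv hg] at this
  · omega
  · exact div_ne_zero (algebraMap_frac_ne_zero hF) (algebraMap_frac_ne_zero hG)

/-! ### Divisors and degrees -/

/-- The monomial `∏ z_j ^ a_j` with integral exponents. -/
noncomputable def fracMonomial (a : Fin (n + 1) → ℤ) :
    FractionRing (MvPolynomial (Fin (n + 1)) ℂ) :=
  ∏ j, algebraMap (MvPolynomial (Fin (n + 1)) ℂ)
    (FractionRing (MvPolynomial (Fin (n + 1)) ℂ)) (X j) ^ a j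

lemma isHomogeneousFrac_fracMonomial (a : Fin (n + 1) → ℤ) :
    IsHomogeneousFrac q (fracMonomial a) (degree q a) := by
  have : degree q a = ∑ j, a j * (q j : ℕ) := Finset.sum_congr rfl fun j _ => mul_comm _ _
  rw [this]
  exact IsHomogeneousFrac.prod Finset.univ fun j _ =>
    (IsHomogeneousFrac.of_mem (X_mem q j) (X_ne_zero j)).zpow (a j)

open scoped Classical in
lemma divisor_apply (a : Fin (n + 1) → ℤ) (y : space q) :
    divisor q a y =
      ∑ j, a j * if y.asHomogeneousIdeal.toIdeal = Ideal.span {X j} then 1 else 0 := by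
  unfold divisor
  rw [Function.locallyFinsuppWithin.coe_sum, Finset.sum_apply]
  rfl

lemma smul_divisor (k : ℕ) (a : Fin (n + 1) → ℤ) :
    k • divisor q a = divisor q fun j => k * a j := by
  simp only [divisor, Finset.smul_sum]
  refine Finset.sum_congr rfl fun j _ => ?_
  rw [← natCast_zsmul, smul_smul]

lemma smul_coordDivisor (k : ℕ) (j : Fin (n + 1)) :
    k • coordDivisor q j = divisor q (Pi.single j (k : ℤ)) := by
  classical
  unfold divisor
  rw [Finset.sum_eq_single j]
  · rw [Pi.single_eq_same, natCast_zsmul]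
  · intro i _ hi
    rw [Pi.single_eq_of_ne hi, zero_smul]
  · simp

lemma degree_single (k : ℤ) (j : Fin (n + 1)) : degree q (Pi.single j k) = q j * k := by
  classical
  unfold degree
  rw [Finset.sum_eq_single j]
  · rw [Pi.single_eq_same]
  · intro i _ hi
    rw [Pi.single_eq_of_ne hi, mul_zero]
  · simp

lemma degree_mul_left (k : ℤ) (a : Fin (n + 1) → ℤ) :
    degree q (fun j => k * a j) = k * degree q a := by
  unfold degree
  rw [Finset.mul_sum]
  exact Finset.sum_congr rfl fun j _ => by ring

lemma fracVal_X {g : MvPolynomial (Fin (n + 1)) ℂ} (hg : Prime g) (j : Fin (n + 1))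
    [Decidable (Ideal.span {g} = Ideal.span {(X j : MvPolynomial (Fin (n + 1)) ℂ)})] :
    fracVal g (algebraMap (MvPolynomial (Fin (n + 1)) ℂ)
      (FractionRing (MvPolynomial (Fin (n + 1)) ℂ)) (X j)) =
      if Ideal.span {g} = Ideal.span {X j} then 1 else 0 := by
  rw [fracVal_algebraMap hg (X_ne_zero j)]
  split_ifs with h
  · rw [Ideal.span_singleton_eq_span_singleton] at h
    rw [multiplicity_eq_of_associated_left h.symm]
    simp [multiplicity_self]
  · rw [multiplicity_eq_zero.mpr]
    · rfl
    · intro h'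
      exact h (Ideal.span_singleton_eq_span_singleton.mpr (hg.associated_of_dvd (X_prime ..) h'))

/-- The coefficient of `∑ a_j D_j` at the prime divisor `g = 0`. -/
lemma divisor_eq_fracVal (a : Fin (n + 1) → ℤ) {y : space q} {g : MvPolynomial (Fin (n + 1)) ℂ}
    (hg : Prime g) (hy : y.asHomogeneousIdeal.toIdeal = Ideal.span {g}) :
    divisor q a y = fracVal g (fracMonomial a) := by
  classical
  rw [divisor_apply, hy, fracMonomial, fracVal_prod hg]
  · refine Finset.sum_congr rfl fun j _ => ?_
    rw [fracVal_zpow hg (algebraMap_frac_ne_zero (X_ne_zero j)), fracVal_X hg]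
  · exact fun j _ => zpow_ne_zero _ (algebraMap_frac_ne_zero (X_ne_zero j))

/-- A point at which `div f + D` has a nonzero coefficient is a prime divisor `g = 0`. -/
lemma exists_prime_of_ord_add_divisor_ne_zero [NeZero n] {f : (space q).functionField}
    (a : Fin (n + 1) → ℤ) {y : space q} (h : Scheme.ord f y + divisor q a y ≠ 0) :
    ∃ (e : ℕ) (g : MvPolynomial (Fin (n + 1)) ℂ), Prime g ∧ g ∈ grading q e ∧
      y.asHomogeneousIdeal.toIdeal = Ideal.span {g} := by
  classical
  by_cases hy : Order.coheight y = 1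
  · exact exists_prime_of_coheight_eq_one q hy
  · rw [Scheme.ord_eq_zero_of_coheight_neq_one hy, zero_add, divisor_apply] at h
    obtain ⟨j, -, hj⟩ := Finset.exists_ne_zero_of_sum_ne_zero h
    refine ⟨_, X j, X_prime .., X_mem q j, ?_⟩
    by_contra hne
    rw [if_neg hne, mul_zero] at hj
    exact hj rfl

variable (hq0 : q 0 = 1)
  (hgcd : (Finset.univ : Finset (Fin n)).gcd (fun j => (q j.succ : ℕ)) = 1)

include hq0 hgcd

/-- The coefficient of `div f + ∑ a_j D_j` at the prime divisor `g = 0` is the multiplicity of `g`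
in the homogeneous fraction `f ∏ z_j ^ a_j`. -/
lemma ord_add_divisor {f : (space q).functionField} (hf : f ≠ 0) (a : Fin (n + 1) → ℤ)
    {y : space q} {e : ℕ} {g : MvPolynomial (Fin (n + 1)) ℂ} (hg : Prime g) (he : g ∈ grading q e)
    (hy : y.asHomogeneousIdeal.toIdeal = Ideal.span {g}) :
    Scheme.ord f y + divisor q a y = fracVal g (ratFun q f * fracMonomial a) := by
  rw [ord_eq_fracVal hq0 hgcd hg he hy hf, divisor_eq_fracVal a hg hy,
    fracVal_mul hg (IsHomogeneousFrac.ratFun hf).ne_zero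
      (isHomogeneousFrac_fracMonomial (q := q) a).ne_zero]

end WeightedProj

namespace WeightedProj

open MvPolynomial

variable {n : ℕ} {q : Fin (n + 1) → ℕ+}

/-! ### Cartier divisors -/

lemma ord_inv {f : (space q).functionField} (hf : f ≠ 0) (y : space q) :
    Scheme.ord f⁻¹ y = - Scheme.ord f y := by
  have h1 := Scheme.ord_mul (x := y) (one_ne_zero (α := (space q).functionField)) one_ne_zero
  have h2 := Scheme.ord_mul (x := y) hf (inv_ne_zero hf)
  rw [mul_inv_cancel₀ hf] at h2
  rw [one_mul] at h1
  omega

/-- The section `z_j ^ e` of `𝒪(D)`, where `D` has degree `q_j e`, as a rational function. -/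
lemma exists_section (a : Fin (n + 1) → ℤ) {j : Fin (n + 1)} {e : ℤ}
    (h : degree q a = q j * e) : ∃ f : (space q).functionField, f ≠ 0 ∧
      ratFun q f * fracMonomial a =
        algebraMap (MvPolynomial (Fin (n + 1)) ℂ)
          (FractionRing (MvPolynomial (Fin (n + 1)) ℂ)) (X j) ^ e := by
  have h1 := ((IsHomogeneousFrac.of_mem (X_mem q j) (X_ne_zero j)).zpow e).mul
    (isHomogeneousFrac_fracMonomial (q := q) a).inv
  rw [h, show e * ((q j : ℕ) : ℤ) + -((q j : ℕ) * e) = 0 by ring] at h1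
  obtain ⟨f, hf, hf'⟩ := h1.exists_ratFun_eq
  refine ⟨f, hf, ?_⟩
  rw [hf', inv_mul_cancel_right₀ (isHomogeneousFrac_fracMonomial (q := q) a).ne_zero]

lemma fracVal_X_eq_zero {g : MvPolynomial (Fin (n + 1)) ℂ} (hg : Prime g) {j : Fin (n + 1)}
    (h : ¬ g ∣ X j) : fracVal g (algebraMap (MvPolynomial (Fin (n + 1)) ℂ)
      (FractionRing (MvPolynomial (Fin (n + 1)) ℂ)) (X j)) = 0 := by
  rw [fracVal_algebraMap hg (X_ne_zero j), multiplicity_eq_zero.mpr h]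
  rfl

/-- The homomorphism `ℂ[z₀, …, zₙ] → ℂ[t]` sending `z_j` to `t` and the other variables to `0`. -/
noncomputable def coordHom (j : Fin (n + 1)) :
    MvPolynomial (Fin (n + 1)) ℂ →ₐ[ℂ] Polynomial ℂ :=
  aeval (Pi.single j Polynomial.X)

lemma coeff_coordHom (j : Fin (n + 1)) (F : MvPolynomial (Fin (n + 1)) ℂ) (k : ℕ) :
    (coordHom j F).coeff k = coeff (Finsupp.single j k) F := by
  classical
  induction F using MvPolynomial.induction_on' with
  | monomial m c =>
    rw [coordHom, aeval_monomial, coeff_monomial]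
    by_cases h : m = Finsupp.single j (m j)
    · rw [h, Finsupp.prod_single_index (by simp)]
      simp [Polynomial.coeff_X_pow, (Finsupp.single_injective j).eq_iff, eq_comm]
    · have h1 : ∃ i ≠ j, m i ≠ 0 := by
        by_contra! h2
        refine h (Finsupp.ext fun i => ?_)
        by_cases hi : i = j
        · rw [hi, Finsupp.single_eq_same]
        · rw [h2 i hi, Finsupp.single_eq_of_ne hi]
      obtain ⟨i, hij, hi⟩ := h1
      rw [if_neg, Finsupp.prod, Finset.prod_eq_zero (i := i) (by simpa using hi)]
      · simp
      · simp [Pi.single_eq_of_ne hij, hi]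
      · rintro rfl
        simp [Finsupp.single_eq_of_ne hij] at hi
  | add p q hp hq => rw [map_add, Polynomial.coeff_add, hp, hq, coeff_add]

variable (q) in
/-- The `j`-th coordinate point, at which all coordinates but `z_j` vanish. -/
noncomputable def coordPt (j : Fin (n + 1)) : space q where
  asHomogeneousIdeal := ⟨RingHom.ker (coordHom j), fun k F hF => by
    rw [coe_decompose, RingHom.mem_ker]
    rw [RingHom.mem_ker] at hF
    ext1 l
    have := congrArg (fun p => Polynomial.coeff p l) hF
    simp only [coeff_coordHom, Polynomial.coeff_zero] at this
    rw [coeff_coordHom, coeff_weightedHomogeneousComponent, this]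
    simp⟩
  isPrime := RingHom.ker_isPrime _
  not_irrelevant_le h := by
    have h1 : coordHom j (X j) = 0 := by
      refine h ?_
      rw [HomogeneousIdeal.mem_irrelevant_iff, GradedRing.proj_apply]
      exact DirectSum.decompose_of_mem_ne (grading q) (X_mem q j) (q j).pos.ne'
    simp [coordHom] at h1

/-- A homogeneous polynomial that does not vanish at the `j`-th coordinate point contains a power
of `z_j`, so its degree is a multiple of `q_j`. -/
lemma dvd_of_notMem_coordPt {j : Fin (n + 1)} {k : ℕ} {F : MvPolynomial (Fin (n + 1)) ℂ}
    (hF : F ∈ grading q k) (h : F ∉ (coordPt q j).asHomogeneousIdeal.toIdeal) :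
    (q j : ℕ) ∣ k := by
  have h1 : coordHom j F ≠ 0 := h
  obtain ⟨l, hl⟩ : ∃ l, (coordHom j F).coeff l ≠ 0 := by
    by_contra! h2
    exact h1 (Polynomial.ext h2)
  rw [coeff_coordHom] at hl
  have h2 : Finsupp.weight (fun j => (q j : ℕ)) (Finsupp.single j l) = k := hF hl
  rw [Finsupp.weight_single] at h2
  exact ⟨l, by rw [← h2, smul_eq_mul, mul_comm]⟩

variable (hq0 : q 0 = 1)
  (hgcd : (Finset.univ : Finset (Fin n)).gcd (fun j => (q j.succ : ℕ)) = 1)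

include hq0 hgcd

/-- On the chart `z_j ≠ 0`, where `z_j ^ e` with `q_j e = deg D` has no zeros, `D` is the divisor
of the inverse of the rational function given by that section. -/
lemma isCartier_of_dvd [NeZero n] (a : Fin (n + 1) → ℤ) (h : ∀ j, (q j : ℤ) ∣ degree q a) :
    WeilDivisor.IsCartier (divisor q a) := by
  intro x
  obtain ⟨j, hj⟩ := exists_X_notMem q x
  obtain ⟨e, he⟩ := h j
  obtain ⟨f, hf, hfa⟩ := exists_section a he
  refine ⟨Proj.basicOpen (grading q) (X j), hj, f⁻¹, inv_ne_zero hf, fun y hy => ?_⟩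
  rw [ord_inv hf]
  by_contra hne
  have hne' : Scheme.ord f y + divisor q a y ≠ 0 := by omega
  obtain ⟨k, g, hg, hk, hgy⟩ := exists_prime_of_ord_add_divisor_ne_zero a hne'
  have hgX : ¬ g ∣ X j := by
    rw [← Ideal.mem_span_singleton, ← hgy]
    exact hy
  rw [ord_add_divisor hq0 hgcd hf a hg hk hgy, hfa,
    fracVal_zpow hg (algebraMap_frac_ne_zero (X_ne_zero j)), fracVal_X_eq_zero hg hgX] at hne'
  simp at hne'

/-- Compare a local equation of `D` with `∏ z_j ^ a_j` at the `j`-th coordinate point: their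
quotient is a quotient of homogeneous polynomials not vanishing there. -/
lemma dvd_of_isCartier [NeZero n] (a : Fin (n + 1) → ℤ)
    (h : WeilDivisor.IsCartier (divisor q a)) (j : Fin (n + 1)) : (q j : ℤ) ∣ degree q a := by
  obtain ⟨U, hxU, f, hf, hfU⟩ := h (coordPt q j)
  have hu := (IsHomogeneousFrac.ratFun hf).inv.mul (isHomogeneousFrac_fracMonomial (q := q) a)
  rw [neg_zero, zero_add] at hu
  have hv {e : ℕ} {g : MvPolynomial (Fin (n + 1)) ℂ} (hg : Prime g) (he : g ∈ grading q e)
      (hgx : g ∈ (coordPt q j).asHomogeneousIdeal.toIdeal) :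
      fracVal g ((ratFun q f)⁻¹ * fracMonomial a) = 0 := by
    have hsp : primePt q hg he ⤳ coordPt q j := by
      refine specializes_of_le q ?_
      rw [primePt_toIdeal, Ideal.span_singleton_le_iff_mem]
      exact hgx
    have h1 := hfU _ (hsp.mem_open U.2 hxU)
    have h2 := ord_add_divisor hq0 hgcd (inv_ne_zero hf) a hg he (primePt_toIdeal q hg he)
    rw [map_inv₀] at h2
    rw [← h2, ord_inv hf]
    omega
  obtain ⟨k, l, F, G, hF, hG, hF0, hG0, hd, hFG, hrel⟩ := hu.exists_isRelPrime
  rw [hFG] at hv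
  have hk : (q j : ℕ) ∣ k := by
    refine dvd_of_notMem_coordPt hF fun hmem => ?_
    obtain ⟨e, g, hg, he, hgx, hgF⟩ := exists_prime_dvd_of_mem q hF hF0 hmem
    exact (fracVal_pos_of_isRelPrime hF0 hG0 hrel hg hgF).ne' (hv hg he hgx)
  have hl : (q j : ℕ) ∣ l := by
    refine dvd_of_notMem_coordPt hG fun hmem => ?_
    obtain ⟨e, g, hg, he, hgx, hgG⟩ := exists_prime_dvd_of_mem q hG hG0 hmem
    exact (fracVal_neg_of_isRelPrime hF0 hG0 hrel hg hgG).ne (hv hg he hgx)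
  rw [← hd]
  exact dvd_sub (Int.natCast_dvd_natCast.mpr hk) (Int.natCast_dvd_natCast.mpr hl)

/-! ### Ample divisors -/

/-- If all `q_j` divide `deg D > 0`, the section `z_j ^ (deg D / q_j)` of `𝒪(D)` has the chart
`z_j ≠ 0` as its nonvanishing locus. -/
lemma isAmpleCartier_of_dvd [NeZero n] (a : Fin (n + 1) → ℤ) (h : ∀ j, (q j : ℤ) ∣ degree q a)
    (hpos : 0 < degree q a) : WeilDivisor.IsAmpleCartier (divisor q a) := by
  refine ⟨QuasiCompact.compactSpace_of_compactSpace (Proj.toSpecZero (grading q)),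
    isCartier_of_dvd hq0 hgcd a h, fun x => ⟨1, le_rfl, ?_⟩⟩
  obtain ⟨j, hj⟩ := exists_X_notMem q x
  obtain ⟨e, he⟩ := h j
  have he0 : 0 < e := by
    rw [he] at hpos
    exact pos_of_mul_pos_right hpos (by positivity)
  obtain ⟨f, hf, hfa⟩ := exists_section a he
  have hord {y : space q} {k : ℕ} {g : MvPolynomial (Fin (n + 1)) ℂ} (hg : Prime g)
      (hk : g ∈ grading q k) (hgy : y.asHomogeneousIdeal.toIdeal = Ideal.span {g}) :
      Scheme.ord f y + divisor q a y = e * multiplicity g (X j) := by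
    rw [ord_add_divisor hq0 hgcd hf a hg hk hgy, hfa,
      fracVal_zpow hg (algebraMap_frac_ne_zero (X_ne_zero j)), fracVal_algebraMap hg (X_ne_zero j)]
  rw [one_smul]
  refine ⟨f, ⟨hf, fun y => ?_⟩, Proj.basicOpen (grading q) (X j), ?_,
    Proj.isAffineOpen_basicOpen (grading q) _ (X_mem q j) (q j).pos, hj⟩
  · by_contra! hlt
    obtain ⟨k, g, hg, hk, hgy⟩ := exists_prime_of_ord_add_divisor_ne_zero a hlt.ne
    rw [hord hg hk hgy] at hlt
    exact absurd hlt (not_lt.mpr (by positivity))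
  · ext z
    constructor
    · intro hz y hy hzy
      obtain ⟨k, g, hg, hk, hgy⟩ := exists_prime_of_ord_add_divisor_ne_zero a hy
      rw [hord hg hk hgy] at hy
      have hgX : g ∣ X j := by
        by_contra hdvd
        rw [multiplicity_eq_zero.mpr hdvd] at hy
        simp at hy
      rw [← Ideal.mem_span_singleton, ← hgy] at hgX
      exact hz ((ProjectiveSpectrum.le_iff_mem_closure (grading q) y z).mpr hzy hgX)
    · intro hz hXz
      have hX : Prime (X j : MvPolynomial (Fin (n + 1)) ℂ) := X_prime ..
      refine hz (primePt q hX (X_mem q j)) ?_ ?_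
      · rw [hord hX (X_mem q j) (primePt_toIdeal q hX _), multiplicity_self]
        simpa using he0.ne'
      · refine (ProjectiveSpectrum.le_iff_mem_closure (grading q) _ z).mp ?_
        change Ideal.span {X j} ≤ z.asHomogeneousIdeal.toIdeal
        rw [Ideal.span_singleton_le_iff_mem]
        exact hXz

end WeightedProj

namespace WeightedProj

open MvPolynomial

variable {n : ℕ} {q : Fin (n + 1) → ℕ+}

/-- A homogeneous fraction without poles is a polynomial. -/
lemma IsHomogeneousFrac.exists_eq_algebraMap {x : FractionRing (MvPolynomial (Fin (n + 1)) ℂ)}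
    {d : ℤ} (hx : IsHomogeneousFrac q x d)
    (h : ∀ {e : ℕ} {g : MvPolynomial (Fin (n + 1)) ℂ}, Prime g → g ∈ grading q e →
      0 ≤ fracVal g x) :
    ∃ (k : ℕ) (F : MvPolynomial (Fin (n + 1)) ℂ), F ∈ grading q k ∧ F ≠ 0 ∧ (k : ℤ) = d ∧
      x = algebraMap _ _ F := by
  obtain ⟨k, l, F, G, hF, hG, hF0, hG0, rfl, rfl, hrel⟩ := hx.exists_isRelPrime
  have hGu : IsUnit G := by
    by_contra hGu
    obtain ⟨g, hg, hgG⟩ := WfDvdMonoid.exists_irreducible_factor hGu hG0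
    obtain ⟨e, he⟩ := exists_mem_of_dvd q hG0 hG hgG
    exact absurd (h hg.prime he) (not_le.mpr (fracVal_neg_of_isRelPrime hF0 hG0 hrel hg.prime hgG))
  obtain ⟨H, hGH⟩ := hGu.exists_right_inv
  have h1 : G * H ≠ 0 := by rw [hGH]; exact one_ne_zero
  have h2 : G * H ∈ grading q 0 := by rw [hGH]; exact SetLike.GradedOne.one_mem
  obtain ⟨r, hr⟩ := exists_mem_of_dvd q h1 h2 (Dvd.intro_left G rfl)
  have h3 := degree_eq_of_mem q h1 h2 (SetLike.mul_mem_graded hG hr)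
  refine ⟨k + r, F * H, SetLike.mul_mem_graded hF hr, mul_ne_zero hF0 (right_ne_zero_of_mul h1),
    by omega, ?_⟩
  rw [div_eq_iff (algebraMap_frac_ne_zero hG0), ← map_mul, mul_assoc, mul_comm H, hGH, mul_one]

lemma isUnit_of_mem_zero {F : MvPolynomial (Fin (n + 1)) ℂ} (hF : F ∈ grading q 0) (h0 : F ≠ 0) :
    IsUnit F := by
  obtain ⟨c, hc⟩ := algebraMap_zero_surjective q ⟨F, hF⟩
  have hc' : C c = F := congrArg Subtype.val hc
  rw [← hc'] at h0 ⊢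
  refine IsUnit.map C (IsUnit.mk0 c ?_)
  rintro rfl
  exact h0 (map_zero C)

/-- If the whole space were affine, some global function `s` would vanish at the prime divisor
`z₀ = 0` and not at the generic point. A nonzero global function has no poles, so it is a
homogeneous polynomial of degree zero, a nonzero constant. -/
lemma not_isAffineOpen_top [NeZero n] : ¬ IsAffineOpen (⊤ : (space q).Opens) := by
  intro h
  have hX : Prime (X 0 : MvPolynomial (Fin (n + 1)) ℂ) := X_prime ..
  let y : space q := primePt q hX (X_mem q 0)
  have hη : genericPt q ∈ Proj.basicOpen (grading q) (X 0) := X_ne_zero (R := ℂ) (0 : Fin (n + 1))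
  obtain ⟨s, hs, hsη⟩ := h.exists_basicOpen_le (V := Proj.basicOpen (grading q) (X 0))
    ⟨genericPt q, hη⟩ trivial
  have hsy : ¬ IsUnit ((space q).presheaf.germ ⊤ y (TopologicalSpace.Opens.mem_top y) s) := by
    intro hu
    have h1 : y ∈ (space q).basicOpen s := ((space q).mem_basicOpen'' s y).mpr ⟨trivial, hu⟩
    exact hs h1 (Ideal.mem_span_singleton_self _)
  have : Nonempty (⊤ : (space q).Opens) := ⟨⟨genericPt q, TopologicalSpace.Opens.mem_top _⟩⟩
  let f : (space q).functionField := (space q).germToFunctionField ⊤ s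
  have hfz (z : space q) : ratFun q f =
      Proj.stalkToFrac (grading q) z
        ((space q).presheaf.germ ⊤ z (TopologicalSpace.Opens.mem_top z) s) := by
    rw [← ratFun_algebraMap, Scheme.algebraMap_germ_eq_germToFunctionField]
  have hf : f ≠ 0 := by
    intro h0
    have h1 : s = 0 := (map_eq_zero_iff _ ((space q).germToFunctionField_injective ⊤)).mp h0
    rw [h1, Scheme.basicOpen_zero] at hsη
    exact hsη
  obtain ⟨k, F, hF, hF0, hk, hfF⟩ := (IsHomogeneousFrac.ratFun hf).exists_eq_algebraMap
    fun {e g} hg he => by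
      obtain ⟨l, F, G, hF, hG, hGz, hFG⟩ := Proj.exists_of_stalkToFrac (grading q)
        (primePt q hg he) ((space q).presheaf.germ ⊤ _ (TopologicalSpace.Opens.mem_top _) s)
      rw [← hfz] at hFG
      have hG0 : G ≠ 0 := fun h => hGz (h ▸ zero_mem _)
      have hF0 : F ≠ 0 := by
        rintro rfl
        rw [map_zero, zero_div] at hFG
        exact (IsHomogeneousFrac.ratFun hf).ne_zero hFG
      rw [primePt_toIdeal, Ideal.mem_span_singleton] at hGz
      have := algebraMap_frac_ne_zero hG0
      rw [hFG, fracVal_eq hg hF0 hG0 (by field_simp), multiplicity_eq_zero.mpr hGz]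
      simp
  obtain rfl : k = 0 := by exact_mod_cast hk
  have hFu := isUnit_of_mem_zero hF hF0
  have hyp := y.isPrime
  refine hsy (isUnit_stalk q hF (SetLike.GradedOne.one_mem (A := grading q))
    (fun hmem => hyp.ne_top (Ideal.eq_top_of_isUnit_mem _ hmem hFu))
    (fun hmem => hyp.ne_top ((Ideal.eq_top_iff_one _).mpr hmem)) ?_)
  rw [← hfz, hfF, map_one, div_one]

lemma neZero_of_gcd (hgcd : (Finset.univ : Finset (Fin n)).gcd (fun j => (q j.succ : ℕ)) = 1) :
    NeZero n := by
  refine ⟨?_⟩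
  rintro rfl
  simp at hgcd

variable (hq0 : q 0 = 1)
  (hgcd : (Finset.univ : Finset (Fin n)).gcd (fun j => (q j.succ : ℕ)) = 1)

include hq0 hgcd

/-- A divisor of negative degree has no sections; in degree zero a section has no zeros, and its
nonvanishing locus, the whole space, is not affine. -/
lemma degree_pos_of_isAmple [NeZero n] (a : Fin (n + 1) → ℤ)
    (h : WeilDivisor.IsAmple (divisor q a)) : 0 < degree q a := by
  obtain ⟨k, hk, -, -, hample⟩ := h
  obtain ⟨l, hl, f, ⟨hf, hsec⟩, U, hU, hUaff, -⟩ := hample (genericPt q)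
  rw [smul_divisor, smul_divisor] at hsec hU
  set b : Fin (n + 1) → ℤ := fun j => l * (k * a j) with hb
  have hdeg : degree q b = l * (k * degree q a) := by
    rw [hb, degree_mul_left, degree_mul_left]
  have hu := (IsHomogeneousFrac.ratFun hf).mul (isHomogeneousFrac_fracMonomial (q := q) b)
  rw [zero_add] at hu
  obtain ⟨r, F, hF, hF0, hr, hfF⟩ := hu.exists_eq_algebraMap fun {e g} hg he => by
    rw [← ord_add_divisor hq0 hgcd hf b hg he (primePt_toIdeal q hg he)]
    exact hsec _
  have hlk : (0 : ℤ) < l * k := by positivity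
  have hr' : (r : ℤ) = (l * k) * degree q a := by rw [hr, hdeg, mul_assoc]
  have hr0 : r ≠ 0 := by
    rintro rfl
    have hFu := isUnit_of_mem_zero hF hF0
    refine not_isAffineOpen_top (n := n) (q := q) ?_
    convert hUaff
    ext1
    rw [hU, eq_comm]
    refine Set.eq_univ_of_forall fun x y hy => ?_
    obtain ⟨e, g, hg, he, hgy⟩ := exists_prime_of_ord_add_divisor_ne_zero b hy
    rw [ord_add_divisor hq0 hgcd hf b hg he hgy, hfF, fracVal_algebraMap hg hF0,
      multiplicity_eq_zero.mpr fun hgF => hg.not_isUnit (isUnit_of_dvd_unit hgF hFu)] at hy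
    exact absurd rfl hy
  refine pos_of_mul_pos_right (a := (l * k : ℤ)) ?_ hlk.le
  rw [← hr']
  omega

end WeightedProj

/-! ### Ring homomorphisms that scale degrees -/

namespace HomogeneousLocalization

universe u

variable {A B σ τ : Type u} [CommRing A] [SetLike σ A] [CommRing B] [SetLike τ B]
  {𝒜 : ℕ → σ} {ℬ : ℕ → τ}
  (φ : B →+* A) {M : ℕ} (hφ : ∀ k, ∀ x ∈ ℬ k, φ x ∈ 𝒜 (k * M))

/-- The function underlying `HomogeneousLocalization.scaledMap`. -/
def scaledFun {P : Submonoid B} {Q : Submonoid A} (h : P ≤ Q.comap φ)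
    (z : HomogeneousLocalization ℬ P) : HomogeneousLocalization 𝒜 Q :=
  Quotient.map' (fun x : NumDenSameDeg ℬ P ↦
      (⟨x.deg * M, ⟨_, hφ _ _ x.num.2⟩, ⟨_, hφ _ _ x.den.2⟩, Submonoid.mem_comap.1 (h x.den_mem)⟩ :
        NumDenSameDeg 𝒜 Q))
    (fun x y (e : x.embedding = y.embedding) ↦ by
      simp only [NumDenSameDeg.embedding, Localization.mk_eq_mk'] at e
      have e' := congrArg (IsLocalization.map (Localization Q) φ h) e
      rw [IsLocalization.map_mk', IsLocalization.map_mk'] at e'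
      change Localization.mk _ _ = Localization.mk _ _
      rw [Localization.mk_eq_mk']
      exact e') z

lemma val_scaledFun {P : Submonoid B} {Q : Submonoid A} (h : P ≤ Q.comap φ)
    (z : HomogeneousLocalization ℬ P) : (scaledFun (𝒜 := 𝒜) φ hφ h z).val =
      IsLocalization.map (Localization Q) φ (T := Q) h z.val := by
  obtain ⟨x, rfl⟩ := mk_surjective z
  rw [val_mk, Localization.mk_eq_mk', IsLocalization.map_mk', ← Localization.mk_eq_mk']
  rfl

variable [AddSubgroupClass σ A] [AddSubgroupClass τ B] [GradedRing 𝒜] [GradedRing ℬ]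

/-- The map on homogeneous localizations induced by a ring homomorphism that multiplies degrees
by `M`. -/
def scaledMap {P : Submonoid B} {Q : Submonoid A} (h : P ≤ Q.comap φ) :
    HomogeneousLocalization ℬ P →+* HomogeneousLocalization 𝒜 Q where
  toFun := scaledFun φ hφ h
  map_add' x y := val_injective _ <| by simp only [val_add, val_scaledFun, map_add]
  map_mul' x y := val_injective _ <| by simp only [val_mul, val_scaledFun, map_mul]
  map_zero' := val_injective _ <| by simp only [val_zero, val_scaledFun, map_zero]
  map_one' := val_injective _ <| by simp only [val_one, val_scaledFun, map_one]

lemma val_scaledMap {P : Submonoid B} {Q : Submonoid A} (h : P ≤ Q.comap φ)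
    (z : HomogeneousLocalization ℬ P) : (scaledMap (𝒜 := 𝒜) φ hφ h z).val =
      IsLocalization.map (Localization Q) φ (T := Q) h z.val :=
  val_scaledFun φ hφ h z

/-- The map `B_(b) → A_(φ b)` of degree zero parts induced by a ring homomorphism `φ` that
multiplies degrees by `M`. -/
def scaledAway (b : B) : Away ℬ b →+* Away 𝒜 (φ b) :=
  scaledMap φ hφ (Submonoid.powers_le.2 (Submonoid.mem_comap.2 (Submonoid.mem_powers _)))

lemma scaledAway_mk {b : B} {d : ℕ} (hb : b ∈ ℬ d) (k : ℕ) (x : B) (hx : x ∈ ℬ (k • d)) :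
    scaledAway (𝒜 := 𝒜) φ hφ b (Away.mk ℬ hb k x hx) =
      Away.mk 𝒜 (hφ d b hb) k (φ x) (by
        simpa only [smul_eq_mul, mul_assoc] using hφ _ x hx) := by
  apply val_injective
  rw [scaledAway, val_scaledMap, Away.val_mk, Away.val_mk, Localization.mk_eq_mk',
    Localization.mk_eq_mk', IsLocalization.map_mk']
  congr 1
  exact Subtype.ext (map_pow φ b k)

lemma val_scaledAway_fromZeroRingHom (b : B) (x : ℬ 0) :
    (scaledAway (𝒜 := 𝒜) φ hφ b (fromZeroRingHom ℬ _ x)).val = algebraMap A _ (φ x) := by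
  rw [scaledAway, val_scaledMap]
  exact IsLocalization.map_eq _ _

lemma scaledAway_awayMap {b c x : B} {d e : ℕ} (hb : b ∈ ℬ d) (hc : c ∈ ℬ e) (hx : x = b * c)
    (z : Away ℬ b) :
    scaledAway (𝒜 := 𝒜) φ hφ x (awayMap ℬ hc hx z) =
      awayMap 𝒜 (hφ e c hc) (hx ▸ map_mul φ b c : φ x = φ b * φ c) (scaledAway φ hφ b z) := by
  obtain ⟨k, y, hy, rfl⟩ := Away.mk_surjective ℬ hb z
  rw [awayMap_mk, scaledAway_mk, scaledAway_mk, awayMap_mk]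
  apply val_injective
  simp only [Away.val_mk, map_mul, map_pow]

lemma scaledAway_surjective
    (hsurj : ∀ k, ∀ a ∈ 𝒜 (k * M), ∃ F ∈ ℬ k, φ F = a) {b : B} (hb : b ∈ ℬ 1) :
    Function.Surjective (scaledAway (𝒜 := 𝒜) φ hφ b) := by
  intro z
  obtain ⟨k, y, hy, rfl⟩ := Away.mk_surjective 𝒜 (hφ 1 b hb) z
  obtain ⟨F, hF, rfl⟩ := hsurj k y (by simpa using hy)
  exact ⟨Away.mk ℬ hb k F (by simpa using hF), scaledAway_mk φ hφ hb k F _⟩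

end HomogeneousLocalization

/-! ### Morphisms between `Proj`s from homomorphisms that scale degrees -/

namespace AlgebraicGeometry.Proj

open HomogeneousLocalization

universe u

variable {A B σ τ : Type u} [CommRing A] [SetLike σ A] [AddSubgroupClass σ A]
  [CommRing B] [SetLike τ B] [AddSubgroupClass τ B]
  {𝒜 : ℕ → σ} {ℬ : ℕ → τ} [GradedRing 𝒜] [GradedRing ℬ]

/-- Homogeneous elements of positive degree without common zero give an affine open cover of
`Proj` by the spectra of the degree zero localizations. -/
noncomputable def awayCover {ι : Type u} {d : ℕ} (f : ι → A) (hf : ∀ i, f i ∈ 𝒜 d) (hd : 0 < d)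
    (hcov : ∀ x : Proj 𝒜, ∃ i, f i ∉ x.asHomogeneousIdeal) : (Proj 𝒜).AffineOpenCover where
  I₀ := ι
  X i := .of (Away 𝒜 (f i))
  f i := awayι 𝒜 (f i) (hf i) hd
  idx x := (hcov x).choose
  covers x := by
    change x ∈ (awayι 𝒜 _ _ _).opensRange
    rw [opensRange_awayι]
    exact (hcov x).choose_spec

variable (φ : B →+* A) {M : ℕ} (hφ : ∀ k, ∀ x ∈ ℬ k, φ x ∈ 𝒜 (k * M)) (hM : 0 < 1 * M)
  {ι : Type u} (b : ι → B) (hb : ∀ i, b i ∈ ℬ 1)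

/-- The morphism from the chart `D₊(φ b)` to the chart `D₊(b)` followed by the inclusion. -/
noncomputable def scaledChart (i : ι) :
    Spec (.of (Away 𝒜 (φ (b i)))) ⟶ Proj ℬ :=
  Spec.map (CommRingCat.ofHom (scaledAway φ hφ (b i))) ≫ awayι ℬ (b i) (hb i) one_pos

/-- The restriction of the `i`-th chart morphism to an intersection `D₊(φ (b i) φ c)` depends only
on the product `b i * c`, which is the compatibility needed for gluing. -/
lemma specMap_awayMap_scaledChart (i : ι) {c x : B} (hc : c ∈ ℬ 1) (hx : x = b i * c)
    (hx' : φ x = φ (b i) * φ c) :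
    Spec.map (CommRingCat.ofHom (awayMap 𝒜 (hφ 1 c hc) hx')) ≫ scaledChart φ hφ b hb i =
      Spec.map (CommRingCat.ofHom (scaledAway (𝒜 := 𝒜) φ hφ x)) ≫
        awayι ℬ x (hx ▸ SetLike.mul_mem_graded (hb i) hc) (by decide) := by
  rw [scaledChart, ← SpecMap_awayMap_awayι ℬ (hb i) one_pos hc hx, ← Spec.map_comp_assoc,
    ← Spec.map_comp_assoc, ← CommRingCat.ofHom_comp, ← CommRingCat.ofHom_comp]
  congr 3
  exact RingHom.ext fun z ↦ (scaledAway_awayMap φ hφ (hb i) hc hx z).symm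

variable (hcov : ∀ x : Proj 𝒜, ∃ i, φ (b i) ∉ x.asHomogeneousIdeal)

/-- The morphism `Proj 𝒜 ⟶ Proj ℬ` induced by a ring homomorphism `φ` that multiplies degrees by
`M > 0`, if there are elements `b i` of degree one such that the `φ (b i)` have no common zero. -/
noncomputable def scaledMorphism : Proj 𝒜 ⟶ Proj ℬ :=
  (awayCover (fun i ↦ φ (b i)) (fun i ↦ hφ 1 _ (hb i)) hM hcov).openCover.glueMorphisms
    (fun i ↦ scaledChart φ hφ b hb i) fun i j ↦ by
      change Limits.pullback.fst (awayι 𝒜 (φ (b i)) (hφ 1 _ (hb i)) hM)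
        (awayι 𝒜 (φ (b j)) (hφ 1 _ (hb j)) hM) ≫ scaledChart φ hφ b hb i =
        Limits.pullback.snd _ _ ≫ scaledChart φ hφ b hb j
      rw [← cancel_epi (pullbackAwayιIso 𝒜 (hφ 1 _ (hb i)) hM (hφ 1 _ (hb j)) hM
        (map_mul φ (b i) (b j))).inv, pullbackAwayιIso_inv_fst_assoc,
        pullbackAwayιIso_inv_snd_assoc,
        specMap_awayMap_scaledChart φ hφ b hb i (hb j) rfl,
        specMap_awayMap_scaledChart φ hφ b hb j (hb i) (mul_comm _ _)]

lemma awayι_scaledMorphism (i : ι) :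
    awayι 𝒜 (φ (b i)) (hφ 1 _ (hb i)) hM ≫ scaledMorphism φ hφ hM b hb hcov =
      Spec.map (CommRingCat.ofHom (scaledAway φ hφ (b i))) ≫ awayι ℬ (b i) (hb i) one_pos :=
  (awayCover (fun i ↦ φ (b i)) (fun i ↦ hφ 1 _ (hb i)) hM hcov).openCover.ι_glueMorphisms
    (fun i ↦ scaledChart φ hφ b hb i) _ i

/-- On the chart `D₊(φ (b j))`, the open set `D₊(b i)` is the locus where `b i / b j` is invertible,
and the function defining `D₊(φ (b i))` is the `M`-th power of its image. -/
lemma scaledMorphism_preimage_basicOpen (i : ι) :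
    scaledMorphism φ hφ hM b hb hcov ⁻¹ᵁ basicOpen ℬ (b i) = basicOpen 𝒜 (φ (b i)) := by
  ext x
  obtain ⟨j, hj⟩ := hcov x
  have hxj : x ∈ (awayι 𝒜 (φ (b j)) (hφ 1 _ (hb j)) hM).opensRange := by
    rw [opensRange_awayι]; exact hj
  obtain ⟨y, rfl⟩ := hxj
  have h1 : awayι 𝒜 (φ (b j)) (hφ 1 _ (hb j)) hM ⁻¹ᵁ
      (scaledMorphism φ hφ hM b hb hcov ⁻¹ᵁ basicOpen ℬ (b i)) =
      awayι 𝒜 (φ (b j)) (hφ 1 _ (hb j)) hM ⁻¹ᵁ basicOpen 𝒜 (φ (b i)) := by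
    rw [← Scheme.Hom.comp_preimage, awayι_scaledMorphism, Scheme.Hom.comp_preimage,
      awayι_preimage_basicOpen ℬ (hb j) one_pos (hb i) one_pos,
      awayι_preimage_basicOpen 𝒜 (hφ 1 _ (hb j)) hM (hφ 1 _ (hb i)) hM]
    have h2 : Away.isLocalizationElem (hφ 1 _ (hb j)) (hφ 1 _ (hb i)) =
        scaledAway (𝒜 := 𝒜) φ hφ (b j) (Away.isLocalizationElem (hb j) (hb i)) ^ (1 * M) := by
      rw [scaledAway_mk]
      apply val_injective
      rw [val_pow, Away.val_mk, Away.val_mk, Localization.mk_pow]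
      simp
    rw [h2]
    ext z
    change _ ↔ z ∈ PrimeSpectrum.basicOpen _
    rw [PrimeSpectrum.basicOpen_pow _ _ hM]
    rfl
  exact SetLike.ext_iff.mp h1 y

/-- If every element of degree divisible by `M` lifts along `φ`, the induced morphism of `Proj`s
is a closed immersion: on each chart it is the spectrum of a surjective ring homomorphism. -/
lemma isClosedImmersion_scaledMorphism (hcov' : ∀ x : Proj ℬ, ∃ i, b i ∉ x.asHomogeneousIdeal)
    (hsurj : ∀ k, ∀ a ∈ 𝒜 (k * M), ∃ F ∈ ℬ k, φ F = a) :
    IsClosedImmersion (scaledMorphism φ hφ hM b hb hcov) := by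
  refine IsZariskiLocalAtTarget.of_openCover (P := @IsClosedImmersion)
    (awayCover b hb one_pos hcov').openCover fun i ↦ ?_
  have h := IsOpenImmersion.isPullback _ _ _ _ (awayι_scaledMorphism φ hφ hM b hb hcov i) (by
    rw [opensRange_awayι, opensRange_awayι]
    exact scaledMorphism_preimage_basicOpen φ hφ hM b hb hcov i)
  have h3 : IsClosedImmersion (Spec.map (CommRingCat.ofHom (scaledAway (𝒜 := 𝒜) φ hφ (b i)))) :=
    IsClosedImmersion.spec_of_surjective _ (scaledAway_surjective φ hφ hsurj (hb i))
  change IsClosedImmersion (Limits.pullback.snd (scaledMorphism φ hφ hM b hb hcov)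
    (awayι ℬ (b i) (hb i) one_pos))
  have h4 := h.flip.isoPullback_inv_snd
  rw [← h4]
  infer_instance

end AlgebraicGeometry.Proj

namespace WeightedProj

open MvPolynomial

variable {n : ℕ} (q : Fin (n + 1) → ℕ+)

/-! ### Projectivity -/

lemma monomial_mem (b : Fin (n + 1) →₀ ℕ) (c : ℂ) :
    monomial b c ∈ grading q (Finsupp.weight (fun j => (q j : ℕ)) b) :=
  isWeightedHomogeneous_monomial _ _ _ rfl

/-- A submodule contains a weighted homogeneous polynomial as soon as it contains all monomials
of its degree. -/
lemma mem_of_forall_monomial_mem {k : ℕ} {S : Submodule ℂ (MvPolynomial (Fin (n + 1)) ℂ)}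
    (h : ∀ b, Finsupp.weight (fun j => (q j : ℕ)) b = k → monomial b 1 ∈ S)
    {F : MvPolynomial (Fin (n + 1)) ℂ} (hF : F ∈ grading q k) : F ∈ S := by
  rw [F.as_sum]
  refine Submodule.sum_mem _ fun b hb => ?_
  have := S.smul_mem (coeff b F) (h b (hF (mem_support_iff.mp hb)))
  rwa [smul_monomial, smul_eq_mul, mul_one] at this

/-- Every monomial whose weight is `l m` with `l ≥ n + 1` is divisible by a monomial of weight
`(n + 1) m`: as long as the weight is larger, some `b_j q_j` is at least `m` by the pigeonhole
principle, and a factor `z_j ^ (m / q_j)` may be removed. -/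
lemma exists_le_weight_eq {m : ℕ} (hdvd : ∀ j, (q j : ℕ) ∣ m) (k : ℕ) (b : Fin (n + 1) →₀ ℕ)
    (hb : Finsupp.weight (fun j => (q j : ℕ)) b = (n + 1) * m + k * m) :
    ∃ c ≤ b, Finsupp.weight (fun j => (q j : ℕ)) c = (n + 1) * m := by
  induction k generalizing b with
  | zero => exact ⟨b, le_rfl, by simpa using hb⟩
  | succ k ih =>
    obtain ⟨j, hj⟩ : ∃ j, m ≤ b j * q j := by
      by_contra! h
      have h1 : ∑ j, b j * (q j : ℕ) < ∑ _j : Fin (n + 1), m :=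
        Finset.sum_lt_sum_of_nonempty Finset.univ_nonempty fun j _ => h j
      rw [Finsupp.weight_eq_sum] at hb
      simp only [smul_eq_mul] at hb
      rw [hb, Finset.sum_const, Finset.card_univ, Fintype.card_fin, smul_eq_mul] at h1
      omega
    obtain ⟨t, ht⟩ := hdvd j
    have hle : Finsupp.single j t ≤ b := by
      rw [Finsupp.single_le_iff]
      rw [ht, mul_comm] at hj
      exact Nat.le_of_mul_le_mul_right hj (q j).pos
    have hw : Finsupp.weight (fun j => (q j : ℕ)) (b - Finsupp.single j t) =
        (n + 1) * m + k * m := by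
      have h2 := congrArg (Finsupp.weight (fun j => (q j : ℕ))) (tsub_add_cancel_of_le hle)
      rw [map_add, hb, Finsupp.weight_single, smul_eq_mul, mul_comm t, ← ht] at h2
      linarith
    obtain ⟨c, hc, hcw⟩ := ih _ hw
    exact ⟨c, hc.trans tsub_le_self, hcw⟩

/-- The monomials of weight `(n + 1) m` can be enumerated by `0, …, N`: there are finitely many, and
a power of `z₀` is one of them. -/
lemma exists_enumeration {m : ℕ} (hdvd : ∀ j, (q j : ℕ) ∣ m) :
    ∃ (N : ℕ) (e : Fin (N + 1) → (Fin (n + 1) →₀ ℕ)), Set.range e =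
      {b | Finsupp.weight (fun j => (q j : ℕ)) b = (n + 1) * m} := by
  have hfin := Finsupp.finite_of_nat_weight_eq (fun j => (q j : ℕ)) (fun j => (q j).pos.ne')
    ((n + 1) * m)
  obtain ⟨N, e, -, he⟩ := hfin.fin_param
  obtain ⟨t, ht⟩ := hdvd 0
  have hmem : Finsupp.single 0 ((n + 1) * t) ∈ Set.range e := by
    rw [he, Set.mem_ofPred_eq, Finsupp.weight_single, smul_eq_mul, ht]
    ring
  obtain ⟨i, -⟩ := hmem
  obtain ⟨N, rfl⟩ : ∃ N', N = N' + 1 := ⟨N - 1, by have := i.pos; omega⟩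
  exact ⟨N, e, he⟩

section Veronese

variable {N : ℕ} (e : Fin (N + 1) → (Fin (n + 1) →₀ ℕ))

/-- The homomorphism `ℂ[y₀, …, y_N] → ℂ[z₀, …, zₙ]` sending `y_i` to the monomial with exponent
`e i`. -/
noncomputable def veronese : MvPolynomial (Fin (N + 1)) ℂ →ₐ[ℂ] MvPolynomial (Fin (n + 1)) ℂ :=
  aeval fun i => monomial (e i) 1

lemma veronese_X (i : Fin (N + 1)) : veronese e (X i) = monomial (e i) 1 :=
  aeval_X _ _

lemma veronese_mem {M : ℕ} (he : ∀ i, Finsupp.weight (fun j => (q j : ℕ)) (e i) = M) (k : ℕ)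
    (F : MvPolynomial (Fin (N + 1)) ℂ) (hF : F ∈ grading (fun _ : Fin (N + 1) => 1) k) :
    veronese e F ∈ grading q (k * M) := by
  refine mem_of_forall_monomial_mem (fun _ : Fin (N + 1) => 1)
    (S := (grading q (k * M)).comap (veronese e).toLinearMap) (fun b hb => ?_) hF
  rw [Submodule.mem_comap, AlgHom.toLinearMap_apply, veronese, aeval_monomial, map_one, one_mul]
  have h := SetLike.prod_pow_mem_graded (grading q) (F := b.support) (fun _ => M)
    (fun i => monomial (e i) (1 : ℂ)) b
    (fun i _ => he i ▸ monomial_mem q (e i) 1)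
  rw [← Finset.sum_smul] at h
  rw [Finsupp.weight_apply, Finsupp.sum] at hb
  simp only [PNat.one_coe, smul_eq_mul, mul_one] at hb
  rwa [hb, smul_eq_mul] at h

/-- By `exists_le_weight_eq`, a monomial of degree `k (n + 1) m` is a product of `k` monomials of
degree `(n + 1) m`. -/
lemma exists_veronese_eq {m : ℕ} (hdvd : ∀ j, (q j : ℕ) ∣ m)
    (he : Set.range e = {b | Finsupp.weight (fun j => (q j : ℕ)) b = (n + 1) * m}) (k : ℕ)
    {F : MvPolynomial (Fin (n + 1)) ℂ} (hF : F ∈ grading q (k * ((n + 1) * m))) :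
    ∃ G ∈ grading (fun _ : Fin (N + 1) => 1) k, veronese e G = F := by
  refine mem_of_forall_monomial_mem q
    (S := (grading (fun _ : Fin (N + 1) => 1) k).map (veronese e).toLinearMap) (fun b hb => ?_) hF
  clear hF
  induction k generalizing b with
  | zero =>
    rw [zero_mul] at hb
    have : Finsupp.NonTorsionWeight ℕ (fun j => (q j : ℕ)) :=
      Finsupp.nonTorsionWeight_of ℕ _ (fun j => (q j).pos.ne')
    rw [(Finsupp.weight_eq_zero_iff_eq_zero (fun j => (q j : ℕ))).mp hb]
    exact ⟨1, SetLike.GradedOne.one_mem, map_one (veronese e)⟩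
  | succ k ih =>
    obtain ⟨c, hc, hcw⟩ := exists_le_weight_eq q hdvd (k * (n + 1)) b (by rw [hb]; ring)
    obtain ⟨i, rfl⟩ : c ∈ Set.range e := by rw [he]; exact hcw
    have h2 := congrArg (Finsupp.weight (fun j => (q j : ℕ))) (tsub_add_cancel_of_le hc)
    rw [map_add, hb, hcw, add_mul k, one_mul] at h2
    obtain ⟨G, hG, hGe⟩ := ih (b - e i) (add_right_cancel h2)
    refine ⟨G * X i, SetLike.mul_mem_graded hG (X_mem _ i), ?_⟩
    rw [AlgHom.toLinearMap_apply] at hGe ⊢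
    rw [map_mul, hGe, veronese_X, monomial_mul, mul_one, tsub_add_cancel_of_le hc]

end Veronese

/-- The morphism given by all monomials of degree `(n + 1) m` is a closed immersion into an
ordinary projective space. -/
theorem isProjectiveOverC_of_dvd {m : ℕ} (hm : 0 < m) (hdvd : ∀ j, (q j : ℕ) ∣ m) :
    IsProjectiveOverC (structureMorphism q) := by
  obtain ⟨N, e, he⟩ := exists_enumeration q hdvd
  have he' (i) : Finsupp.weight (fun j => (q j : ℕ)) (e i) = (n + 1) * m := by
    have := Set.mem_range_self (f := e) i
    rwa [he] at this
  have hφ : ∀ k, ∀ F ∈ grading (fun _ : Fin (N + 1) => 1) k,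
      (veronese e).toRingHom F ∈ grading q (k * ((n + 1) * m)) := veronese_mem q e he'
  have hM : 0 < 1 * ((n + 1) * m) := by positivity
  have hX (i : Fin (N + 1)) : (X i : MvPolynomial (Fin (N + 1)) ℂ) ∈
      grading (fun _ : Fin (N + 1) => 1) 1 := X_mem _ i
  have hcov (x : space q) : ∃ i, (veronese e).toRingHom (X i) ∉ x.asHomogeneousIdeal := by
    obtain ⟨j, hj⟩ := exists_X_notMem q x
    obtain ⟨t, ht⟩ := hdvd j
    obtain ⟨i, hi⟩ : Finsupp.single j ((n + 1) * t) ∈ Set.range e := by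
      rw [he, Set.mem_ofPred_eq, Finsupp.weight_single, smul_eq_mul, ht]
      ring
    -- A power of `z_j` is among the monomials.
    refine ⟨i, fun h => hj ?_⟩
    rw [AlgHom.toRingHom_eq_coe, RingHom.coe_coe, veronese_X, hi, ← X_pow_eq_monomial] at h
    exact x.isPrime.mem_of_pow_mem _ h
  refine ⟨N, Proj.scaledMorphism (veronese e).toRingHom hφ hM X hX hcov,
    Proj.isClosedImmersion_scaledMorphism _ _ _ _ _ _ (exists_X_notMem _)
      (fun k _ => exists_veronese_eq q e hdvd he k), ?_⟩
  have key (i : Fin (N + 1)) :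
      Proj.awayι (grading q) _ (hφ 1 _ (hX i)) hM ≫
        Proj.scaledMorphism (veronese e).toRingHom hφ hM X hX hcov ≫
          structureMorphism (fun _ : Fin (N + 1) => 1) =
      Proj.awayι (grading q) _ (hφ 1 _ (hX i)) hM ≫ structureMorphism q := by
    rw [← Category.assoc]
    erw [Proj.awayι_scaledMorphism (veronese e).toRingHom hφ hM X hX hcov i]
    rw [structureMorphism, structureMorphism,
      Category.assoc, Proj.awayι_toSpecZero_assoc, Proj.awayι_toSpecZero_assoc,
      ← Spec.map_comp, ← Spec.map_comp, ← Spec.map_comp]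
    congr 1
    ext c
    refine (HomogeneousLocalization.val_scaledAway_fromZeroRingHom (veronese e).toRingHom hφ
      (X i) (algebraMap ℂ (grading (fun _ : Fin (N + 1) => 1) 0) c)).trans ?_
    exact congrArg (algebraMap _ (Localization _)) (algHom_C (veronese e) c)
  exact (Proj.awayCover _ (fun i => hφ 1 _ (hX i)) hM hcov).openCover.hom_ext _ _ key

end WeightedProj

/-! ### Divisor criteria and projectivity -/

theorem mainTheorem12 (n : ℕ) (q : Fin (n + 1) → ℕ+) (hq0 : q 0 = 1)
    (hgcd : (Finset.univ : Finset (Fin n)).gcd (fun j => (q j.succ : ℕ)) = 1)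
    (m : ℕ) (hm : m = (Finset.univ : Finset (Fin n)).lcm (fun j => (q j.succ : ℕ))) :
    (∀ a : Fin (n + 1) → ℤ,
      (WeilDivisor.IsCartier (WeightedProj.divisor q a) ↔ (m : ℤ) ∣ WeightedProj.degree q a) ∧
      (WeilDivisor.IsAmple (WeightedProj.divisor q a) ↔ 0 < WeightedProj.degree q a)) ∧
    WeilDivisor.IsAmpleCartier (m • WeightedProj.coordDivisor q 0) ∧
    WeightedProj.IsProjectiveOverC (WeightedProj.structureMorphism q) := by
  have hn := WeightedProj.neZero_of_gcd hgcd
  have hdvd (j : Fin (n + 1)) : (q j : ℕ) ∣ m := by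
    induction j using Fin.cases with
    | zero => simp [hq0]
    | succ j => exact hm ▸ Finset.dvd_lcm (Finset.mem_univ j)
  have hm0 : 0 < m := by
    rw [hm, Nat.pos_iff_ne_zero, Ne, Finset.lcm_eq_zero_iff]
    rintro ⟨j, -, hj⟩
    exact (q j.succ).pos.ne' hj
  have hiff (d : ℤ) : (m : ℤ) ∣ d ↔ ∀ j, (q j : ℤ) ∣ d := by
    refine ⟨fun h j => (Int.natCast_dvd_natCast.mpr (hdvd j)).trans h, fun h => ?_⟩
    rw [hm, Int.natCast_dvd]
    exact Finset.lcm_dvd fun j _ => Int.natCast_dvd.mp (h j.succ)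
  -- For ampleness use the multiple `m D`, whose degree `m d` is divisible by all `q_j`.
  refine ⟨fun a => ⟨?_, ?_, fun hpos => ⟨m, hm0, ?_⟩⟩, ?_,
    WeightedProj.isProjectiveOverC_of_dvd q hm0 hdvd⟩
  · rw [hiff]
    exact ⟨WeightedProj.dvd_of_isCartier hq0 hgcd a, WeightedProj.isCartier_of_dvd hq0 hgcd a⟩
  · exact WeightedProj.degree_pos_of_isAmple hq0 hgcd a
  · rw [WeightedProj.smul_divisor]
    refine WeightedProj.isAmpleCartier_of_dvd hq0 hgcd _ ((hiff _).mp ?_) ?_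
    · rw [WeightedProj.degree_mul_left]
      exact dvd_mul_right _ _
    · rw [WeightedProj.degree_mul_left]
      positivity
  · rw [WeightedProj.smul_coordDivisor]
    refine WeightedProj.isAmpleCartier_of_dvd hq0 hgcd _ ((hiff _).mp ?_) ?_
    · rw [WeightedProj.degree_single]
      exact dvd_mul_left _ _
    · rw [WeightedProj.degree_single]
      have := (q 0).pos
      positivity
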